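/- Let $\boldsymbol\Omega\in\mathbb R^{p\times n}$ be a matrix with $p,n\ge 1$ and full rank $\min(p,n)$, so that its smallest singular value is positive, and let $\kappa(\boldsymbol\Omega)=\sigma_{\max}(\boldsymbol\Omega)/\sigma_{\min}(\boldsymbol\Omega)$ be its condition number, where $\sigma_{\max}$ and $\sigma_{\min}$ are the largest and the smallest of its $\min(p,n)$ singular values. Let $\mathcal P_1,\dots,\mathcal P_L$ be a partition of $[p]=\{1,\dots,p\}$ into nonempty sets, let $\omega_1,\dots,\omega_L\ge 0$, and let $\boldsymbol w=\sum_{i=1}^L\omega_i\mathbf 1_{\mathcal P_i}\in\mathbb R^p$. Let $\boldsymbol x\in\mathbb R^n$, let $\mathcal S=\{j\in[p]:(\boldsymbol{\Omega x})_j\neq 0\}$, $s=|\mathcal S|$, and put $$\rho_i=\frac{|\mathcal P_i|}{p},\qquad \alpha_i=\frac{|\mathcal P_i\cap\mathcal S|}{|\mathcal P_i|}\qquad (i=1,\dots,L).$$ For $\boldsymbol z\in\mathbb R^p$ let $\|\boldsymbol z\|_{1,\boldsymbol w}=\sum_{j=1}^p w_j|z_j|$. For a convex function $f:\mathbb R^p\to\mathbb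 R$ and $\boldsymbol y\in\mathbb R^p$ let $\mathcal D(f,\boldsymbol y)=\bigcup_{\tau>0}\{\boldsymbol z\in\mathbb R^p: f(\boldsymbol y+\tau\boldsymbol z)\le f(\boldsymbol y)\}$ be the descent cone. For a convex cone $\mathcal C\subseteq\mathbb R^p$ with polar cone $\mathcal C^\circ=\{\boldsymbol u:\langle\boldsymbol u,\boldsymbol z\rangle\le 0\ \ \forall \boldsymbol z\in\mathcal C\}$ let $\delta(\mathcal C)=\mathbb E\,\mathrm{dist}^2(\boldsymbol g,\mathcal C^\circ)$ be its statistical dimension, where $\boldsymbol g$ is a standard normal vector in $\mathbb R^p$ and $\mathrm{dist}$ is the Euclidean distance. Define the normalized number of measurements for weighted $\ell_1$-analysis by $$m_{p,s,\boldsymbol w}=\kappa^2(\boldsymbol\Omega)\,\frac{\delta\big(\mathcal D(\|\cdot\|_{1,\boldsymbol w},\boldsymbol{\Omega x})\big)}{p}+\frac1p,$$ and define $$\hat m_{p,s,\boldsymbol w}=\kappa^2(\boldsymbol\Omega)\,\inf_{t\ge 0}\Psi_{t,\boldsymbol w}+\frac1p,\qquad \Psi_{t,\boldsymbol w}=\sum_{i=1}^L\rho_i\Big(\alpha_i(t^2\omega_i^2+1)+(1-\alpha_i)\,\phi(t\omega_i)\Big),$$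 where $\phi(z)=\sqrt{2/\pi}\int_z^\infty (u-z)^2e^{-u^2/2}\,du$. Then $$\hat m_{p,s,\boldsymbol w}-\frac{2\kappa^2(\boldsymbol\Omega)}{\sqrt{pL}}\ \le\ m_{p,s,\boldsymbol w}\ \le\ \hat m_{p,s,\boldsymbol w}.$$ -/

import Mathlib

open MeasureTheory ProbabilityTheory

noncomputable section

namespace WeightedAnalysis

/-- The vector `Ω x`, with the Euclidean norm on both sides. -/
def analyze {p n : ℕ} (Ω : Matrix (Fin p) (Fin n) ℝ) (x : EuclideanSpace ℝ (Fin n)) :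
    EuclideanSpace ℝ (Fin p) :=
  Matrix.toEuclideanLin Ω x

/-- Largest singular value of a real `p × n` matrix (singular values are listed in decreasing
order, starting from index `0`). -/
def sigmaMax {p n : ℕ} (Ω : Matrix (Fin p) (Fin n) ℝ) : ℝ :=
  (Matrix.toEuclideanLin Ω).singularValues 0

/-- Smallest of the `min p n` singular values of a real `p × n` matrix. -/
def sigmaMin {p n : ℕ} (Ω : Matrix (Fin p) (Fin n) ℝ) : ℝ :=
  (Matrix.toEuclideanLin Ω).singularValues (min p n - 1)

/-- Condition number `κ(Ω) = σ_max(Ω) / σ_min(Ω)` (meaningful when `0 < σ_min(Ω)`). -/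
def kappa {p n : ℕ} (Ω : Matrix (Fin p) (Fin n) ℝ) : ℝ :=
  sigmaMax Ω / sigmaMin Ω

/-- Descent cone of `f` at `y`: the directions along which `f` does not increase for at least one
positive step size. -/
def descentCone {p : ℕ} (f : EuclideanSpace ℝ (Fin p) → ℝ) (y : EuclideanSpace ℝ (Fin p)) :
    Set (EuclideanSpace ℝ (Fin p)) :=
  {z | ∃ τ : ℝ, 0 < τ ∧ f (y + τ • z) ≤ f y}

/-- Polar cone `C° = {u : ⟨u, z⟩ ≤ 0 for all z ∈ C}`. -/
def polarCone {p : ℕ} (C : Set (EuclideanSpace ℝ (Fin p))) : Set (EuclideanSpace ℝ (Fin p)) :=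
  {u | ∀ z ∈ C, inner ℝ u z ≤ 0}

/-- Statistical dimension `δ(C) = 𝔼 dist²(g, C°)` of a convex cone, `g` a standard normal vector. -/
def statDim {p : ℕ} (C : Set (EuclideanSpace ℝ (Fin p))) : ℝ :=
  ∫ g, (Metric.infDist g (polarCone C)) ^ 2 ∂(stdGaussian (EuclideanSpace ℝ (Fin p)))

/-- Weighted `ℓ¹` norm `‖z‖_{1,w} = ∑ j, w j |z j|`. -/
def weightedL1 {p : ℕ} (w : Fin p → ℝ) (z : EuclideanSpace ℝ (Fin p)) : ℝ :=
  ∑ j, w j * |z j|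

/-- The weight vector `w = ∑ i, ω i 1_{P i}` that is constant on each part of a partition. -/
def blockWeights {p L : ℕ} (P : Fin L → Finset (Fin p)) (ω : Fin L → ℝ) : Fin p → ℝ :=
  fun j => ∑ i, ω i * (if j ∈ P i then 1 else 0)

/-- The sets `P 1, …, P L` form a partition of the index set into nonempty parts. -/
def IsPartition {p L : ℕ} (P : Fin L → Finset (Fin p)) : Prop :=
  (∀ i, (P i).Nonempty) ∧ (∀ i k, i ≠ k → Disjoint (P i) (P k)) ∧ ∀ j, ∃ i, j ∈ P i

/-- Support of a vector. -/
def supp {p : ℕ} (y : EuclideanSpace ℝ (Fin p)) : Finset (Fin p) :=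
  {j | y j ≠ 0}

/-- Relative size `ρ i = |P i| / p`. -/
def relSize {p L : ℕ} (P : Fin L → Finset (Fin p)) (i : Fin L) : ℝ :=
  ((P i).card : ℝ) / p

/-- Accuracy `α i = |P i ∩ S| / |P i|`. -/
def accuracy {p L : ℕ} (P : Fin L → Finset (Fin p)) (S : Finset (Fin p)) (i : Fin L) : ℝ :=
  ((P i ∩ S).card : ℝ) / ((P i).card : ℝ)

/-- `φ(z) = √(2/π) ∫_z^∞ (u - z)² exp(-u²/2) du`. -/
def phi (z : ℝ) : ℝ :=
  √(2 / Real.pi) * ∫ u in Set.Ioi z, (u - z) ^ 2 * Real.exp (-(u ^ 2) / 2)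

/-- `Ψ_{t,w} = ∑ i, ρ i (α i (t² (ω i)² + 1) + (1 - α i) φ(t ω i))`. -/
def Psi {L : ℕ} (ρ α ω : Fin L → ℝ) (t : ℝ) : ℝ :=
  ∑ i, ρ i * (α i * (t ^ 2 * ω i ^ 2 + 1) + (1 - α i) * phi (t * ω i))

/-- Normalized number of measurements for weighted `ℓ¹`-analysis,
`m_{p,s,w} = κ²(Ω) δ(D(‖·‖_{1,w}, Ω x)) / p + 1 / p`. -/
def numMeas {p n : ℕ} (Ω : Matrix (Fin p) (Fin n) ℝ) (w : Fin p → ℝ)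
    (x : EuclideanSpace ℝ (Fin n)) : ℝ :=
  kappa Ω ^ 2 * (statDim (descentCone (weightedL1 w) (analyze Ω x)) / p) + 1 / p

/-- The explicit upper bound `κ²(Ω) inf_{t ≥ 0} Ψ_{t,w} + 1 / p`, with the parameters `ρ`, `α`
determined by the partition and the support of `Ω x`. -/
def numMeasHat {p n L : ℕ} (Ω : Matrix (Fin p) (Fin n) ℝ) (P : Fin L → Finset (Fin p))
    (ω : Fin L → ℝ) (x : EuclideanSpace ℝ (Fin n)) : ℝ :=
  kappa Ω ^ 2 *
    (⨅ t : Set.Ici (0 : ℝ), Psi (relSize P) (accuracy P (supp (analyze Ω x))) ω (t : ℝ)) + 1 / p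

end WeightedAnalysis

end

/-!
Write `y = Ω x`, `S = supp y`, and let `g` be standard Gaussian. The polar of the descent cone of
`‖·‖_{1,w}` at `y` consists of the multiples `t • u`, `t ≥ 0`, of subgradients `u` at `y`, so
`dist²(g, C°) = inf_t F(g, t)` with `F(g, t) = dist²(g, t • ∂‖y‖_{1,w})`. This `F` depends on `g` only
through the folded vector `r`, whose coordinates are `sign (y j) * g j` on `S` and `|g j|` off it, and
`𝔼 F(g, t) = p Ψ_{t,w}`. Hence `δ / p = 𝔼 inf_t F / p ≤ inf_t Ψ_t`, which is the upper bound. Only two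
consequences of the description of the polar cone are needed: `infDist_polarCone_sq_le` and
`sqDist_optScale_le_infDist_sq`.

For the lower bound, the gap `inf_t 𝔼 F - 𝔼 inf_t F` is at most `2` for every weight vector; this
suffices because `√(pL) ≤ p`. Let `τ` be the smallest minimizer of the convex function `F(g, ·)`
(`optScale`), let `M = 𝔼 τ`, and let `H = -F' / 2` (`slope`). The tangent line at `M` gives
`F(g, τ) ≥ F(g, M) - 2 H(g, M) (τ - M)`, so the gap is at most `2 Cov(H(·, M), τ)`, and this covariance
is at most `1` (`integral_slope_mul_le`), in two steps.

* `H` equals `R = ∑ w j * r j` minus monotone functions of the single coordinates `r j`. As `τ` is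
  monotone in `r`, Chebyshev's association inequality, applied in one coordinate at a time, gives
  `Cov(H, τ) ≤ Cov(R, τ)`.
* `F(r + ε w, t + ε) = F(r, t)`, so `τ(r + ε w) ≤ τ(r) + ε`.
  The law of `r + ε w` has density `exp(ε R - ε² ‖w‖² / 2)` with respect to that of `r`, except that it
  vanishes where some `r j` with `j ∉ S` is below `ε w j`. Comparing `𝔼 τ(r + ε w) ≤ 𝔼 τ + ε` with the
  first-order expansion of the density, and estimating the excluded event by association again,
  yields `Cov(R, τ) ≤ 1` as `ε → 0` (`integral_optScale_mul_weightedSum_le`).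
-/

namespace WeightedAnalysis

/-! ### Distance to a scaled subdifferential along the ray `t ≥ 0` -/

section Scale

variable {ι : Type*} [DecidableEq ι] {S : Finset ι} {w r r' : ι → ℝ} {t t' c : ℝ}

/-- The `j`-th coordinate, up to sign, of the difference between a vector and its nearest point in
`t • ∂‖·‖_{1,w}`. The vector enters through `r`: its coordinates multiplied by the signs of the
base point on the support `S`, and their absolute values off `S`. -/
noncomputable def residual (S : Finset ι) (w r : ι → ℝ) (t : ℝ) (j : ι) : ℝ :=
  if j ∈ S then r j - t * w j else max (r j - t * w j) 0

lemma residual_antitone (hw : ∀ j, 0 ≤ w j) (j : ι) : Antitone fun t => residual S w r t j := by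
  intro a b hab
  have := mul_le_mul_of_nonneg_right hab (hw j)
  dsimp only [residual]
  split_ifs
  · linarith
  · exact max_le_max_right 0 (by linarith)

lemma residual_mono (h : r ≤ r') (t : ℝ) (j : ι) : residual S w r t j ≤ residual S w r' t j := by
  have := h j
  dsimp only [residual]
  split_ifs
  · linarith
  · exact max_le_max_right 0 (by linarith)

lemma residual_add_smul (ε t : ℝ) (j : ι) :
    residual S w (fun i => r i + ε * w i) (t + ε) j = residual S w r t j := by
  have : r j + ε * w j - (t + ε) * w j = r j - t * w j := by ring
  simp only [residual, this]

@[fun_prop]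
lemma continuous_residual (j : ι) :
    Continuous fun q : (ι → ℝ) × ℝ => residual S w q.1 q.2 j := by
  unfold residual
  split_ifs <;> fun_prop

/-- Convexity of the square of one residual, written as a tangent line inequality. -/
lemma residual_sq_tangent (t t' : ℝ) (j : ι) :
    residual S w r t j ^ 2 - 2 * (w j * residual S w r t j) * (t' - t)
      ≤ residual S w r t' j ^ 2 := by
  dsimp only [residual]
  split_ifs
  · nlinarith [sq_nonneg ((t' - t) * w j)]
  · rcases max_cases (r j - t * w j) 0 with ⟨h, h0⟩ | ⟨h, h0⟩ <;>
    rcases max_cases (r j - t' * w j) 0 with ⟨h', h0'⟩ | ⟨h', h0'⟩ <;> rw [h, h']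
    · nlinarith [sq_nonneg ((t' - t) * w j)]
    · nlinarith [mul_nonneg h0 (sub_nonneg.2 h0'.le), sq_nonneg (r j - t * w j)]
    · nlinarith [sq_nonneg (r j - t' * w j)]
    · simp

variable [Fintype ι]

/-- Squared distance of a vector to `t • ∂‖·‖_{1,w}`. -/
noncomputable def sqDist (S : Finset ι) (w r : ι → ℝ) (t : ℝ) : ℝ :=
  ∑ j, residual S w r t j ^ 2

/-- Minus one half of the derivative of `t ↦ sqDist S w r t`. -/
noncomputable def slope (S : Finset ι) (w r : ι → ℝ) (t : ℝ) : ℝ :=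
  ∑ j, w j * residual S w r t j

/-- The smallest minimizer of `t ↦ sqDist S w r t` over `t ≥ 0`. -/
noncomputable def optScale (S : Finset ι) (w r : ι → ℝ) : ℝ :=
  sInf {t | 0 ≤ t ∧ slope S w r t ≤ 0}

lemma sqDist_tangent (t t' : ℝ) :
    sqDist S w r t - 2 * slope S w r t * (t' - t) ≤ sqDist S w r t' := by
  unfold sqDist slope
  rw [Finset.mul_sum, Finset.sum_mul, ← Finset.sum_sub_distrib]
  exact Finset.sum_le_sum fun j _ => residual_sq_tangent t t' j

@[fun_prop]
lemma continuous_slope : Continuous fun q : (ι → ℝ) × ℝ => slope S w q.1 q.2 := by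
  unfold slope
  fun_prop

lemma slope_antitone (hw : ∀ j, 0 ≤ w j) : Antitone (slope S w r) := fun _ _ h =>
  Finset.sum_le_sum fun j _ => mul_le_mul_of_nonneg_left (residual_antitone hw j h) (hw j)

lemma slope_mono (hw : ∀ j, 0 ≤ w j) (h : r ≤ r') (t : ℝ) : slope S w r t ≤ slope S w r' t :=
  Finset.sum_le_sum fun j _ => mul_le_mul_of_nonneg_left (residual_mono h t j) (hw j)

lemma slope_add_smul (ε t : ℝ) :
    slope S w (fun i => r i + ε * w i) (t + ε) = slope S w r t := by
  simp only [slope, residual_add_smul]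

/-- Beyond `∑ |r j| / w j` every residual with positive weight has become nonpositive. Coordinates
with `w j = 0` play no role; there the quotient is zero by convention. -/
lemma slope_sum_div_nonpos (hw : ∀ j, 0 ≤ w j) : slope S w r (∑ j, |r j| / w j) ≤ 0 := by
  refine Finset.sum_nonpos fun j _ => ?_
  rcases (hw j).eq_or_lt with h | h
  · simp [← h]
  have h1 : |r j| / w j ≤ ∑ j, |r j| / w j :=
    Finset.single_le_sum (f := fun j => |r j| / w j)
      (fun i _ => div_nonneg (abs_nonneg _) (hw i)) (Finset.mem_univ j)
  have h2 : r j - (∑ j, |r j| / w j) * w j ≤ 0 := by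
    have := (div_le_iff₀ h).1 h1
    linarith [le_abs_self (r j)]
  refine mul_nonpos_of_nonneg_of_nonpos h.le ?_
  dsimp only [residual]
  split_ifs
  · exact h2
  · exact max_le h2 le_rfl

lemma optScale_nonneg : 0 ≤ optScale S w r := Real.sInf_nonneg fun _ h => h.1

lemma sum_div_mem (hw : ∀ j, 0 ≤ w j) :
    (∑ j, |r j| / w j) ∈ {t | 0 ≤ t ∧ slope S w r t ≤ 0} :=
  ⟨Finset.sum_nonneg fun i _ => div_nonneg (abs_nonneg _) (hw i), slope_sum_div_nonpos hw⟩

lemma bddBelow_scales : BddBelow {t | 0 ≤ t ∧ slope S w r t ≤ 0} := ⟨0, fun _ h => h.1⟩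

lemma optScale_le_sum (hw : ∀ j, 0 ≤ w j) : optScale S w r ≤ ∑ j, |r j| / w j :=
  csInf_le bddBelow_scales (sum_div_mem hw)

lemma slope_optScale_nonpos (hw : ∀ j, 0 ≤ w j) : slope S w r (optScale S w r) ≤ 0 := by
  have hc : Continuous (slope S w r) :=
    continuous_slope.comp (Continuous.prodMk continuous_const continuous_id)
  have hcl : IsClosed {t | 0 ≤ t ∧ slope S w r t ≤ 0} :=
    isClosed_Ici.inter (isClosed_le hc continuous_const)
  exact (hcl.csInf_mem ⟨_, sum_div_mem hw⟩ bddBelow_scales).2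

lemma optScale_le_iff (hw : ∀ j, 0 ≤ w j) (hc : 0 ≤ c) :
    optScale S w r ≤ c ↔ slope S w r c ≤ 0 :=
  ⟨fun h => (slope_antitone hw h).trans (slope_optScale_nonpos hw),
    fun h => csInf_le bddBelow_scales ⟨hc, h⟩⟩

/-- Complementary slackness for the minimization of `sqDist S w r` over `t ≥ 0`. -/
lemma optScale_mul_slope (hw : ∀ j, 0 ≤ w j) :
    optScale S w r * slope S w r (optScale S w r) = 0 := by
  rcases (optScale_nonneg (S := S) (w := w) (r := r)).eq_or_lt with h | h
  · rw [← h, zero_mul]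
  refine mul_eq_zero_of_right _ (le_antisymm (slope_optScale_nonpos hw) ?_)
  -- to the left of the optimal scale the slope is positive
  have hev : ∀ᶠ t in nhdsWithin (optScale S w r) (Set.Iio (optScale S w r)),
      0 ≤ slope S w r t := by
    filter_upwards [Ioo_mem_nhdsLT h] with t ht
    by_contra! hlt
    exact absurd ((optScale_le_iff hw ht.1.le).2 hlt.le) (not_le.2 ht.2)
  have hc : Continuous (slope S w r) :=
    continuous_slope.comp (Continuous.prodMk continuous_const continuous_id)
  exact ge_of_tendsto (hc.continuousWithinAt (s := Set.Iio (optScale S w r))) hev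

lemma optScale_mono (hw : ∀ j, 0 ≤ w j) : Monotone (optScale S w) := fun _ r' h =>
  (optScale_le_iff hw optScale_nonneg).2
    ((slope_mono hw h _).trans (slope_optScale_nonpos (r := r') hw))

/-- Moving every coordinate outward by `ε w j` increases the optimal scale by at most `ε`. -/
lemma optScale_add_smul_le (hw : ∀ j, 0 ≤ w j) {ε : ℝ} (hε : 0 ≤ ε) :
    optScale S w (fun i => r i + ε * w i) ≤ optScale S w r + ε := by
  rw [optScale_le_iff hw (add_nonneg optScale_nonneg hε), slope_add_smul]
  exact slope_optScale_nonpos hw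

lemma measurable_optScale (hw : ∀ j, 0 ≤ w j) : Measurable (optScale S w) := by
  refine measurable_of_Iic fun c => ?_
  rcases le_or_gt 0 c with hc | hc
  · have : optScale S w ⁻¹' Set.Iic c = {r | slope S w r c ≤ 0} := by
      ext r
      exact optScale_le_iff hw hc
    rw [this]
    have hcont : Continuous fun r => slope S w r c :=
      continuous_slope.comp (Continuous.prodMk continuous_id continuous_const)
    exact (isClosed_le hcont continuous_const).measurableSet
  · convert MeasurableSet.empty
    ext r
    simpa using hc.trans_le optScale_nonneg

end Scale

/-! ### The polar of the descent cone of a weighted `ℓ¹` norm -/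

section Polar

variable {p : ℕ} {w : Fin p → ℝ} {y : EuclideanSpace ℝ (Fin p)}

/-- The vector `g` in the coordinates of `residual`: multiplied by the signs of `y` on the support
of `y`, replaced by absolute values off it. -/
noncomputable def folded (y : EuclideanSpace ℝ (Fin p)) (g : Fin p → ℝ) (j : Fin p) : ℝ :=
  if j ∈ supp y then SignType.sign (y j) * g j else |g j|

lemma mem_supp {j : Fin p} : j ∈ supp y ↔ y j ≠ 0 := by simp [supp]

/-- The point `u` of `[-c, c]` nearest to `a`; the difference `a - u` is the soft threshold of `a`. -/
lemma exists_soft_threshold (a : ℝ) {c : ℝ} (hc : 0 ≤ c) :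
    ∃ u : ℝ, |u| ≤ c ∧ |a - u| = max (|a| - c) 0 ∧ (a - u) * u = c * |a - u| := by
  rcases le_or_gt |a| c with h | h
  · exact ⟨a, h, by simp [h], by simp⟩
  · rcases abs_cases a with ⟨h1, h2⟩ | ⟨h1, h2⟩
    · refine ⟨c, (abs_of_nonneg hc).le, ?_, ?_⟩
      · rw [max_eq_left (by linarith), abs_of_nonneg (by linarith), h1]
      · rw [abs_of_nonneg (by linarith), mul_comm]
    · refine ⟨-c, by rw [abs_neg, abs_of_nonneg hc], ?_, ?_⟩
      · rw [max_eq_left (by linarith), abs_of_nonpos (by linarith), h1]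
        ring
      · rw [abs_of_nonpos (by linarith)]
        ring

lemma sign_sq_of_ne_zero {a : ℝ} (ha : a ≠ 0) : ((SignType.sign a : ℝ)) ^ 2 = 1 := by
  rcases lt_or_gt_of_ne ha with h | h <;> simp [h]

/-- The nearest point `u` to `g` in `t • ∂‖·‖_{1,w}(y)`, with the properties that are used: it is a
subgradient, and the coordinates of `g - u` are the residuals, pairing with `u` as with a
subgradient attaining the directional derivative. -/
lemma exists_nearest_subgradient (hw : ∀ j, 0 ≤ w j) (g : EuclideanSpace ℝ (Fin p)) {t : ℝ}
    (ht : 0 ≤ t) :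
    ∃ u : EuclideanSpace ℝ (Fin p),
      (∀ j ∈ supp y, u j = t * w j * SignType.sign (y j)) ∧
      (∀ j ∉ supp y, |u j| ≤ t * w j) ∧
      (∀ j ∈ supp y,
        g j - u j = SignType.sign (y j) * residual (supp y) w (folded y g) t j) ∧
      (∀ j ∉ supp y, |g j - u j| = residual (supp y) w (folded y g) t j) ∧
      (∀ j, (g j - u j) * u j = t * (w j * residual (supp y) w (folded y g) t j)) := by
  have key : ∀ j, ∃ v : ℝ, (j ∈ supp y → v = t * w j * SignType.sign (y j)) ∧
      (j ∉ supp y → |v| ≤ t * w j) ∧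
      (j ∈ supp y → g j - v = SignType.sign (y j) * residual (supp y) w (folded y g) t j) ∧
      (j ∉ supp y → |g j - v| = residual (supp y) w (folded y g) t j) ∧
      (g j - v) * v = t * (w j * residual (supp y) w (folded y g) t j) := by
    intro j
    by_cases hj : j ∈ supp y
    · have h1 := sign_sq_of_ne_zero (mem_supp.1 hj)
      refine ⟨t * w j * SignType.sign (y j), fun _ => rfl, fun h => absurd hj h, fun _ => ?_,
        fun h => absurd hj h, ?_⟩
      · simp only [residual, folded, hj, if_true]
        linear_combination (-g j) * h1
      · simp only [residual, folded, hj, if_true]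
        linear_combination (-(t * w j) ^ 2) * h1
    · obtain ⟨u, h1, h2, h3⟩ := exists_soft_threshold (g j) (mul_nonneg ht (hw j))
      refine ⟨u, fun h => absurd h hj, fun _ => h1, fun h => absurd h hj, fun _ => ?_, ?_⟩
      · simp only [residual, folded, hj, if_false, h2]
      · simp only [residual, folded, hj, if_false, h3, h2]
        ring
  choose v hv using key
  exact ⟨WithLp.toLp 2 v, fun j => (hv j).1, fun j => (hv j).2.1, fun j => (hv j).2.2.1,
    fun j => (hv j).2.2.2.1, fun j => (hv j).2.2.2.2⟩

/-- `t • ∂‖·‖_{1,w}(y)` is contained in the polar of the descent cone. -/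
lemma subgradient_mem_polarCone (hw : ∀ j, 0 ≤ w j) {t : ℝ} (ht : 0 ≤ t)
    {u : EuclideanSpace ℝ (Fin p)}
    (hu : ∀ j ∈ supp y, u j = t * w j * SignType.sign (y j))
    (hu' : ∀ j ∉ supp y, |u j| ≤ t * w j) :
    u ∈ polarCone (descentCone (weightedL1 w) y) := by
  rintro z ⟨a, ha, hz⟩
  have hj : ∀ j, a * (u j * z j) ≤ t * (w j * |(y + a • z) j|) - t * (w j * |y j|) := by
    intro j
    have hyz : (y + a • z) j = y j + a * z j := by simp
    rw [hyz]
    have htw := mul_nonneg ht (hw j)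
    by_cases hj : j ∈ supp y
    · have h0 := mem_supp.1 hj
      rw [hu j hj]
      have h : (SignType.sign (y j) : ℝ) * (a * z j) ≤ |y j + a * z j| - |y j| := by
        rcases lt_or_gt_of_ne h0 with h | h
        · simp only [h, sign_neg, SignType.coe_neg_one, abs_of_neg h]
          linarith [neg_abs_le (y j + a * z j)]
        · simp only [h, sign_pos, SignType.coe_one, abs_of_pos h]
          linarith [le_abs_self (y j + a * z j)]
      nlinarith [mul_le_mul_of_nonneg_left h htw]
    · have h0 : y j = 0 := by simpa [mem_supp] using hj
      have h := hu' j hj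
      rw [h0, zero_add, abs_zero, abs_mul, abs_of_pos ha]
      have h2 : u j * z j ≤ t * w j * |z j| := by
        refine (le_abs_self _).trans ?_
        rw [abs_mul]
        exact mul_le_mul_of_nonneg_right h (abs_nonneg _)
      nlinarith [mul_le_mul_of_nonneg_left h2 ha.le]
  have hsum := Finset.sum_le_sum fun j (_ : j ∈ Finset.univ) => hj j
  rw [Finset.sum_sub_distrib, ← Finset.mul_sum, ← Finset.mul_sum, ← Finset.mul_sum] at hsum
  have hz' : t * weightedL1 w (y + a • z) ≤ t * weightedL1 w y :=
    mul_le_mul_of_nonneg_left hz ht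
  have hin : inner ℝ u z = ∑ j, u j * z j := by
    rw [PiLp.inner_apply]
    exact Finset.sum_congr rfl fun j _ => by simp [mul_comm]
  rw [hin]
  unfold weightedL1 at hz'
  nlinarith

/-- A direction along which the directional derivative of the weighted `ℓ¹` norm is nonpositive lies
in the descent cone, because the norm is affine along short segments. -/
lemma mem_descentCone_of_directional {z : EuclideanSpace ℝ (Fin p)}
    (hz : ∑ j, w j * (if j ∈ supp y then SignType.sign (y j) * z j else |z j|) ≤ 0) :
    z ∈ descentCone (weightedL1 w) y := by
  have hev : ∀ᶠ a in nhdsWithin (0 : ℝ) (Set.Ioi 0), ∀ j ∈ supp y,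
      |y j + a * z j| = |y j| + a * (SignType.sign (y j) * z j) := by
    refine (Finset.eventually_all (supp y)).2 fun j hj => ?_
    have h0 := mem_supp.1 hj
    have hc : Filter.Tendsto (fun a : ℝ => y j + a * z j) (nhds 0) (nhds (y j)) := by
      have : Continuous fun a : ℝ => y j + a * z j := by fun_prop
      simpa using this.tendsto 0
    refine Filter.Eventually.filter_mono nhdsWithin_le_nhds ?_
    rcases lt_or_gt_of_ne h0 with h | h
    · filter_upwards [hc.eventually (gt_mem_nhds h)] with a ha
      rw [abs_of_neg ha, abs_of_neg h, sign_neg h]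
      simp only [SignType.coe_neg_one]
      ring
    · filter_upwards [hc.eventually (lt_mem_nhds h)] with a ha
      rw [abs_of_pos ha, abs_of_pos h, sign_pos h]
      simp only [SignType.coe_one]
      ring
  obtain ⟨a, ha, hpos⟩ := (hev.and self_mem_nhdsWithin).exists
  have hpos : 0 < a := hpos
  refine ⟨a, hpos, ?_⟩
  have : weightedL1 w (y + a • z) = weightedL1 w y +
      a * ∑ j, w j * (if j ∈ supp y then SignType.sign (y j) * z j else |z j|) := by
    unfold weightedL1
    rw [Finset.mul_sum, ← Finset.sum_add_distrib]
    refine Finset.sum_congr rfl fun j _ => ?_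
    have hyz : (y + a • z) j = y j + a * z j := by simp
    rw [hyz]
    split_ifs with hj
    · rw [ha j hj]
      ring
    · have h0 : y j = 0 := by simpa [mem_supp] using hj
      rw [h0, zero_add, abs_zero, abs_mul, abs_of_pos hpos]
      ring
  rw [this]
  nlinarith

lemma norm_sq_eq_sqDist {g u : EuclideanSpace ℝ (Fin p)} {t : ℝ}
    (h : ∀ j ∈ supp y, g j - u j = SignType.sign (y j) * residual (supp y) w (folded y g) t j)
    (h' : ∀ j ∉ supp y, |g j - u j| = residual (supp y) w (folded y g) t j) :
    ‖g - u‖ ^ 2 = sqDist (supp y) w (folded y g) t := by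
  rw [EuclideanSpace.real_norm_sq_eq]
  refine Finset.sum_congr rfl fun j _ => ?_
  rw [PiLp.sub_apply]
  by_cases hj : j ∈ supp y
  · rw [h j hj, mul_pow, sign_sq_of_ne_zero (mem_supp.1 hj), one_mul]
  · rw [← h' j hj, sq_abs]

lemma infDist_polarCone_sq_le (hw : ∀ j, 0 ≤ w j) (g : EuclideanSpace ℝ (Fin p)) {t : ℝ}
    (ht : 0 ≤ t) :
    Metric.infDist g (polarCone (descentCone (weightedL1 w) y)) ^ 2
      ≤ sqDist (supp y) w (folded y g) t := by
  obtain ⟨u, h1, h2, h3, h4, -⟩ := exists_nearest_subgradient (y := y) hw g ht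
  rw [← norm_sq_eq_sqDist h3 h4, ← dist_eq_norm]
  exact pow_le_pow_left₀ Metric.infDist_nonneg
    (Metric.infDist_le_dist_of_mem (subgradient_mem_polarCone hw ht h1 h2)) 2

/-- At the optimal scale the residual vector lies in the descent cone and is orthogonal to the
nearest subgradient, so no point of the polar cone is closer. -/
lemma sqDist_optScale_le_infDist_sq (hw : ∀ j, 0 ≤ w j) (g : EuclideanSpace ℝ (Fin p)) :
    sqDist (supp y) w (folded y g) (optScale (supp y) w (folded y g))
      ≤ Metric.infDist g (polarCone (descentCone (weightedL1 w) y)) ^ 2 := by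
  obtain ⟨u, h1, h2, h3, h4, h5⟩ := exists_nearest_subgradient (y := y) hw g
    (optScale_nonneg (S := supp y) (w := w) (r := folded y g))
  set τ := optScale (supp y) w (folded y g)
  rw [← norm_sq_eq_sqDist h3 h4]
  have hz : g - u ∈ descentCone (weightedL1 w) y := by
    refine mem_descentCone_of_directional ((le_of_eq ?_).trans
      (slope_optScale_nonpos (S := supp y) (w := w) (r := folded y g) hw))
    refine Finset.sum_congr rfl fun j _ => ?_
    rw [PiLp.sub_apply]
    split_ifs with hj
    · rw [h3 j hj, ← mul_assoc (SignType.sign (y j) : ℝ), ← sq,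
        sign_sq_of_ne_zero (mem_supp.1 hj), one_mul]
    · rw [h4 j hj]
  have horth : inner ℝ u (g - u) = 0 := by
    rw [← optScale_mul_slope (S := supp y) (w := w) (r := folded y g) hw, slope, Finset.mul_sum,
      PiLp.inner_apply]
    refine Finset.sum_congr rfl fun j _ => ?_
    rw [← h5 j]
    simp
  refine pow_le_pow_left₀ (norm_nonneg _) ?_ 2
  refine (Metric.le_infDist ⟨u, subgradient_mem_polarCone hw optScale_nonneg h1 h2⟩).2
    fun v hv => ?_
  have hv' : inner ℝ v (g - u) ≤ 0 := hv _ hz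
  rw [dist_eq_norm]
  have hsq : ‖g - u‖ * ‖g - u‖ ≤ ‖g - v‖ * ‖g - u‖ := by
    refine le_trans ?_ (real_inner_le_norm (g - v) (g - u))
    rw [← real_inner_self_eq_norm_mul_norm]
    have : g - v = (g - u) + u - v := by abel
    rw [this, inner_sub_left (g - u + u), inner_add_left, horth]
    linarith
  rcases (norm_nonneg (g - u)).eq_or_lt with h | h
  · rw [← h]
    exact norm_nonneg _
  · exact le_of_mul_le_mul_right hsq h

end Polar

/-! ### The half-normal law and the law of the folded Gaussian vector -/

section Laws

/-- The law of `|X|` for `X` standard normal. -/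
noncomputable def halfNormal : Measure ℝ := (gaussianReal 0 1).map fun x => |x|

instance : IsProbabilityMeasure halfNormal :=
  Measure.isProbabilityMeasure_map (by fun_prop)

lemma gaussianPDFReal_zero_one (x : ℝ) :
    gaussianPDFReal 0 1 x = (√(2 * Real.pi))⁻¹ * Real.exp (-(x ^ 2) / 2) := by
  simp [gaussianPDFReal]

lemma two_mul_inv_sqrt_two_pi : 2 * (√(2 * Real.pi))⁻¹ = √(2 / Real.pi) := by
  rw [Real.sqrt_div zero_le_two, Real.sqrt_mul zero_le_two]
  have h2 : √(2 : ℝ) * √2 = 2 := Real.mul_self_sqrt zero_le_two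
  have hp : √Real.pi ≠ 0 := (Real.sqrt_pos.2 Real.pi_pos).ne'
  field_simp
  linarith

lemma integral_halfNormal {f : ℝ → ℝ} (hf : Measurable f) :
    ∫ x, f x ∂halfNormal = √(2 / Real.pi) * ∫ x in Set.Ioi 0, f x * Real.exp (-(x ^ 2) / 2) := by
  rw [halfNormal, integral_map (by fun_prop) hf.aestronglyMeasurable,
    integral_gaussianReal_eq_integral_smul one_ne_zero]
  have : (fun x : ℝ => gaussianPDFReal 0 1 x • f |x|) =
      fun x => (fun z => (√(2 * Real.pi))⁻¹ * (f z * Real.exp (-(z ^ 2) / 2))) |x| := by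
    ext x
    simp only [gaussianPDFReal_zero_one, smul_eq_mul, sq_abs]
    ring
  rw [this]
  refine (integral_comp_abs (f := fun z =>
    (√(2 * Real.pi))⁻¹ * (f z * Real.exp (-(z ^ 2) / 2)))).trans ?_
  rw [integral_const_mul, ← mul_assoc, two_mul_inv_sqrt_two_pi]

lemma halfNormal_eq_withDensity :
    halfNormal = volume.withDensity fun x => ENNReal.ofReal
      (Set.indicator (Set.Ioi 0) (fun x => √(2 / Real.pi) * Real.exp (-(x ^ 2) / 2)) x) := by
  have hint : Integrable (fun x : ℝ => √(2 / Real.pi) * Real.exp (-(x ^ 2) / 2)) := by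
    have := integrable_gaussianPDFReal 0 1
    refine (this.const_mul 2).congr (Filter.Eventually.of_forall fun x => ?_)
    simp only [gaussianPDFReal_zero_one, ← mul_assoc, two_mul_inv_sqrt_two_pi]
  ext s hs
  have h1 := integral_halfNormal (f := s.indicator 1) (measurable_one.indicator hs)
  rw [integral_indicator_one hs] at h1
  rw [withDensity_apply _ hs, ← ofReal_integral_eq_lintegral_ofReal,
    ← ENNReal.ofReal_toReal (measure_ne_top halfNormal s), ← Measure.real, h1, ← integral_const_mul,
    ← integral_indicator measurableSet_Ioi, ← integral_indicator hs]
  · congr 2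
    ext x
    by_cases h : x ∈ s <;> by_cases h' : x ∈ Set.Ioi (0 : ℝ) <;>
      simp [h, h', Set.indicator_of_mem, Set.indicator_of_notMem]
  · exact (hint.indicator measurableSet_Ioi).integrableOn
  · exact Filter.Eventually.of_forall fun x => Set.indicator_nonneg (fun _ _ => by positivity) x

/-- A translate of a measure with a density, in terms of the quotient of the densities. -/
lemma map_add_const_withDensity {ρ k : ℝ → ℝ} (hρ : Measurable ρ) (hk : Measurable k)
    (hρ0 : ∀ x, 0 ≤ ρ x) {c : ℝ} (h : ∀ x, ρ (x - c) = ρ x * k x) :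
    (volume.withDensity fun x => ENNReal.ofReal (ρ x)).map (fun x => x + c) =
      (volume.withDensity fun x => ENNReal.ofReal (ρ x)).withDensity
        fun x => ENNReal.ofReal (k x) := by
  rw [← withDensity_mul _ hρ.ennreal_ofReal hk.ennreal_ofReal]
  ext s hs
  have hc : Measurable fun x : ℝ => x + c := by fun_prop
  rw [Measure.map_apply hc hs, withDensity_apply _ (hc hs), withDensity_apply _ hs,
    ← lintegral_indicator (hc hs), ← lintegral_indicator hs,
    ← lintegral_add_right_eq_self (Set.indicator s _) c]
  refine lintegral_congr fun x => ?_
  have hx : ρ x = ρ (x + c) * k (x + c) := by rw [← h, add_sub_cancel_right]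
  by_cases hxs : x + c ∈ s
  · rw [Set.indicator_of_mem (show x ∈ (fun x => x + c) ⁻¹' s from hxs),
      Set.indicator_of_mem hxs, Pi.mul_apply,
      ← ENNReal.ofReal_mul (hρ0 _), ← hx]
  · rw [Set.indicator_of_notMem (show x ∉ (fun x => x + c) ⁻¹' s from hxs),
      Set.indicator_of_notMem hxs]

lemma exp_shift (c x : ℝ) :
    Real.exp (-((x - c) ^ 2) / 2) = Real.exp (-(x ^ 2) / 2) * Real.exp (c * x - c ^ 2 / 2) := by
  rw [← Real.exp_add]
  congr 1
  ring

lemma gaussianReal_map_add (c : ℝ) :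
    (gaussianReal 0 1).map (fun x => x + c) =
      (gaussianReal 0 1).withDensity fun x => ENNReal.ofReal (Real.exp (c * x - c ^ 2 / 2)) := by
  rw [gaussianReal_of_var_ne_zero 0 one_ne_zero, gaussianPDF_def]
  refine map_add_const_withDensity (measurable_gaussianPDFReal 0 1) (by fun_prop)
    (gaussianPDFReal_nonneg 0 1) fun x => ?_
  rw [gaussianPDFReal_zero_one, gaussianPDFReal_zero_one, exp_shift, mul_assoc]

lemma halfNormal_map_add {c : ℝ} (hc : 0 ≤ c) :
    halfNormal.map (fun x => x + c) = halfNormal.withDensity fun x => ENNReal.ofReal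
      (Set.indicator (Set.Ioi c) (fun x => Real.exp (c * x - c ^ 2 / 2)) x) := by
  rw [halfNormal_eq_withDensity]
  refine map_add_const_withDensity (Measurable.indicator (by fun_prop) measurableSet_Ioi)
    (Measurable.indicator (by fun_prop) measurableSet_Ioi)
    (fun x => Set.indicator_nonneg (fun _ _ => by positivity) x) fun x => ?_
  by_cases h : c < x
  · rw [Set.indicator_of_mem (show x - c ∈ Set.Ioi 0 from sub_pos.2 h),
      Set.indicator_of_mem (show x ∈ Set.Ioi 0 from hc.trans_lt h),
      Set.indicator_of_mem (show x ∈ Set.Ioi c from h), exp_shift, mul_assoc]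
  · rw [Set.indicator_of_notMem (by simpa using h),
      Set.indicator_of_notMem (a := x) (s := Set.Ioi c) (by simpa using h), mul_zero]

lemma memLp_halfNormal : MemLp id 2 halfNormal := by
  rw [halfNormal, memLp_map_measure_iff (by fun_prop) (by fun_prop)]
  exact (memLp_id_gaussianReal 2).abs

lemma integral_id_halfNormal : ∫ x, x ∂halfNormal = √(2 / Real.pi) := by
  refine (integral_halfNormal measurable_id).trans ?_
  have h := integral_rpow_mul_exp_neg_mul_rpow (p := 2) (q := 1) (b := 1 / 2) two_pos
    (by norm_num) (by norm_num)
  have h2 : ∫ x in Set.Ioi (0 : ℝ), x * Real.exp (-(x ^ 2) / 2) = 1 := by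
    refine Eq.trans (setIntegral_congr_fun measurableSet_Ioi fun x _ => ?_) (h.trans ?_)
    · rw [Real.rpow_one, Real.rpow_two]
      congr 2
      ring
    · norm_num
  simp only [id]
  rw [h2, mul_one]

/-- The half-normal density is at most its value `√(2/π)` at the origin. -/
lemma halfNormal_real_Iic_le {c : ℝ} (hc : 0 ≤ c) :
    halfNormal.real (Set.Iic c) ≤ √(2 / Real.pi) * c := by
  rw [← integral_indicator_one measurableSet_Iic,
    integral_halfNormal (measurable_one.indicator measurableSet_Iic)]
  refine mul_le_mul_of_nonneg_left ?_ (Real.sqrt_nonneg _)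
  have h : ∫ x in Set.Ioi (0 : ℝ), Set.indicator (Set.Ioc 0 c) (fun _ => (1 : ℝ)) x = c := by
    rw [integral_indicator measurableSet_Ioc, Measure.restrict_restrict measurableSet_Ioc,
      Set.inter_eq_self_of_subset_left Set.Ioc_subset_Ioi_self]
    simp [hc]
  refine le_trans (integral_mono_of_nonneg ?_ ?_ ?_) h.le
  · exact Filter.Eventually.of_forall fun x => mul_nonneg
      (Set.indicator_nonneg (fun _ _ => zero_le_one) x) (Real.exp_nonneg _)
  · refine (integrable_indicator_iff measurableSet_Ioc).2 ?_
    refine (integrableOn_const (by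
      rw [Measure.restrict_apply measurableSet_Ioc]
      exact (measure_mono Set.inter_subset_left).trans_lt measure_Ioc_lt_top |>.ne))
  · refine (ae_restrict_iff' measurableSet_Ioi).2 (Filter.Eventually.of_forall fun x hx => ?_)
    have he : Real.exp (-(x ^ 2) / 2) ≤ 1 := Real.exp_le_one_iff.2 (by nlinarith [sq_nonneg x])
    dsimp only
    by_cases hxc : x ≤ c
    · rw [Set.indicator_of_mem (show x ∈ Set.Iic c from hxc),
        Set.indicator_of_mem (show x ∈ Set.Ioc 0 c from ⟨hx, hxc⟩)]
      simpa using he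
    · rw [Set.indicator_of_notMem (show x ∉ Set.Iic c from hxc),
        Set.indicator_of_notMem (show x ∉ Set.Ioc 0 c from fun h => hxc h.2), zero_mul]

lemma integral_soft_sq_halfNormal {z : ℝ} (hz : 0 ≤ z) :
    ∫ x, max (x - z) 0 ^ 2 ∂halfNormal = phi z := by
  rw [integral_halfNormal (by fun_prop), phi]
  congr 1
  rw [← integral_indicator measurableSet_Ioi, ← integral_indicator measurableSet_Ioi]
  congr 1
  ext x
  by_cases h : z < x
  · rw [Set.indicator_of_mem (show x ∈ Set.Ioi 0 from hz.trans_lt h),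
      Set.indicator_of_mem (show x ∈ Set.Ioi z from h), max_eq_left (by linarith)]
  · rw [Set.indicator_of_notMem (a := x) (s := Set.Ioi z) h, Set.indicator_apply]
    split_ifs
    · rw [max_eq_right (by linarith [not_lt.1 h])]
      simp
    · rfl

lemma integral_sub_sq_gaussianReal (a : ℝ) :
    ∫ x, (x - a) ^ 2 ∂(gaussianReal 0 1) = 1 + a ^ 2 := by
  have h1 : Integrable (fun x : ℝ => x) (gaussianReal 0 1) :=
    (memLp_id_gaussianReal 1).integrable le_rfl
  have h2 : Integrable (fun x : ℝ => x ^ 2) (gaussianReal 0 1) :=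
    (memLp_id_gaussianReal 2).integrable_sq
  have h0 : ∫ x : ℝ, x ∂(gaussianReal 0 1) = 0 := integral_id_gaussianReal
  have hv : ∫ x : ℝ, x ^ 2 ∂(gaussianReal 0 1) = 1 := by
    have := variance_fun_id_gaussianReal (μ := 0) (v := 1)
    rw [variance_eq_integral (by fun_prop)] at this
    simpa [h0] using this
  have : (fun x : ℝ => (x - a) ^ 2) = fun x => x ^ 2 - 2 * a * x + a ^ 2 := by
    ext x
    ring
  have h3 : Integrable (fun x : ℝ => x ^ 2 - 2 * a * x) (gaussianReal 0 1) :=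
    h2.sub (h1.const_mul (2 * a))
  rw [this, integral_add h3 (integrable_const _),
    integral_sub h2 (h1.const_mul _), integral_const_mul, h0, hv]
  simp

/-- The law of one coordinate of a folded standard Gaussian vector: normal on the support, half-normal
off it. -/
noncomputable def coordLaw {ι : Type*} [DecidableEq ι] (S : Finset ι) (j : ι) : Measure ℝ :=
  if j ∈ S then gaussianReal 0 1 else halfNormal

instance {ι : Type*} [DecidableEq ι] (S : Finset ι) (j : ι) :
    IsProbabilityMeasure (coordLaw S j) := by
  unfold coordLaw
  split_ifs <;> infer_instance

lemma memLp_coordLaw {ι : Type*} [DecidableEq ι] (S : Finset ι) (j : ι) :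
    MemLp id 2 (coordLaw S j) := by
  unfold coordLaw
  split_ifs
  · exact memLp_id_gaussianReal 2
  · exact memLp_halfNormal

/-- The density of the translate of `coordLaw S j` by `c ≥ 0` with respect to `coordLaw S j`. -/
noncomputable def shiftDensity {ι : Type*} [DecidableEq ι] (S : Finset ι) (j : ι) (c x : ℝ) : ℝ :=
  if j ∈ S ∨ c < x then Real.exp (c * x - c ^ 2 / 2) else 0

lemma shiftDensity_nonneg {ι : Type*} [DecidableEq ι] (S : Finset ι) (j : ι) (c x : ℝ) :
    0 ≤ shiftDensity S j c x := by
  unfold shiftDensity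
  split_ifs <;> positivity

lemma measurable_shiftDensity {ι : Type*} [DecidableEq ι] (S : Finset ι) (j : ι) (c : ℝ) :
    Measurable (shiftDensity S j c) := by
  unfold shiftDensity
  refine Measurable.ite ?_ (by fun_prop) measurable_const
  by_cases h : j ∈ S
  · simp [h]
  · simp only [h, false_or]
    exact measurableSet_Ioi

lemma coordLaw_map_add {ι : Type*} [DecidableEq ι] (S : Finset ι) (j : ι) {c : ℝ} (hc : 0 ≤ c) :
    (coordLaw S j).map (fun x => x + c) =
      (coordLaw S j).withDensity fun x => ENNReal.ofReal (shiftDensity S j c x) := by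
  unfold coordLaw shiftDensity
  by_cases h : j ∈ S
  · simp only [h, if_true, true_or]
    exact gaussianReal_map_add c
  · simp only [h, if_false, false_or]
    rw [halfNormal_map_add hc]
    rfl

lemma map_folded_stdGaussian {p : ℕ} (y : EuclideanSpace ℝ (Fin p)) :
    (stdGaussian (EuclideanSpace ℝ (Fin p))).map (fun g : EuclideanSpace ℝ (Fin p) => folded y g) =
      Measure.pi (coordLaw (supp y)) := by
  have hm : Measurable fun (x : Fin p → ℝ) => folded y x := by
    refine measurable_pi_lambda _ fun j => ?_
    unfold folded
    split_ifs <;> fun_prop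
  rw [← map_pi_eq_stdGaussian, Measure.map_map (g := fun g : EuclideanSpace ℝ (Fin p) => folded y g)
    (hm.comp (by fun_prop)) (by fun_prop)]
  have h1 : ∀ j, (gaussianReal 0 1).map
      (fun x : ℝ => if j ∈ supp y then (SignType.sign (y j) : ℝ) * x else |x|) =
        coordLaw (supp y) j := by
    intro j
    unfold coordLaw
    by_cases h : j ∈ supp y
    · simp only [h, if_true]
      have := gaussianReal_map_const_mul (μ := 0) (v := 1) (SignType.sign (y j) : ℝ)
      rw [this, mul_zero]
      congr 1
      ext
      simp [sign_sq_of_ne_zero (mem_supp.1 h)]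
    · simp only [h, if_false]
      rfl
  have hp (j : Fin p) : IsProbabilityMeasure ((gaussianReal 0 1).map
      (fun x : ℝ => if j ∈ supp y then (SignType.sign (y j) : ℝ) * x else |x|)) := by
    rw [h1]
    infer_instance
  have h2 := Measure.pi_map_pi (μ := fun _ : Fin p => gaussianReal 0 1)
    (f := fun j x => if j ∈ supp y then (SignType.sign (y j) : ℝ) * x else |x|)
    (fun j => by split_ifs <;> fun_prop)
  simp only [h1] at h2
  exact h2

end Laws

/-! ### Association and translation for product measures -/

section Product

/-- Chebyshev's association inequality: two monotone functions are nonnegatively correlated. -/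
lemma integral_mul_integral_le_of_monotone {μ : Measure ℝ} [IsProbabilityMeasure μ] {f h : ℝ → ℝ}
    (hf : Monotone f) (hh : Monotone h) (hfi : Integrable f μ) (hhi : Integrable h μ)
    (hfh : Integrable (fun x => f x * h x) μ) :
    (∫ x, f x ∂μ) * ∫ x, h x ∂μ ≤ ∫ x, f x * h x ∂μ := by
  have h0 : 0 ≤ ∫ q : ℝ × ℝ, (f q.1 - f q.2) * (h q.1 - h q.2) ∂(μ.prod μ) := by
    refine integral_nonneg fun q => ?_
    rcases le_total q.1 q.2 with hq | hq
    · exact mul_nonneg_of_nonpos_of_nonpos (sub_nonpos.2 (hf hq)) (sub_nonpos.2 (hh hq))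
    · exact mul_nonneg (sub_nonneg.2 (hf hq)) (sub_nonneg.2 (hh hq))
  have e : (fun q : ℝ × ℝ => (f q.1 - f q.2) * (h q.1 - h q.2)) =
      fun q => ((f q.1 * h q.1 * 1 + 1 * (f q.2 * h q.2)) - (f q.1 * h q.2 + h q.1 * f q.2)) := by
    ext q
    ring
  have i1 : Integrable (fun q : ℝ × ℝ => f q.1 * h q.1 * 1) (μ.prod μ) :=
    hfh.mul_prod (integrable_const (1 : ℝ))
  have i2 : Integrable (fun q : ℝ × ℝ => 1 * (f q.2 * h q.2)) (μ.prod μ) :=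
    (integrable_const (1 : ℝ)).mul_prod hfh
  have i3 : Integrable (fun q : ℝ × ℝ => f q.1 * h q.2) (μ.prod μ) := hfi.mul_prod hhi
  have i4 : Integrable (fun q : ℝ × ℝ => h q.1 * f q.2) (μ.prod μ) := hhi.mul_prod hfi
  have i12 : Integrable (fun q : ℝ × ℝ => f q.1 * h q.1 * 1 + 1 * (f q.2 * h q.2)) (μ.prod μ) :=
    i1.add i2
  have i34 : Integrable (fun q : ℝ × ℝ => f q.1 * h q.2 + h q.1 * f q.2) (μ.prod μ) := i3.add i4
  rw [e, integral_sub i12 i34, integral_add i1 i2, integral_add i3 i4,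
    integral_prod_mul (fun x => f x * h x) (fun _ => (1 : ℝ)),
    integral_prod_mul (fun _ => (1 : ℝ)) (fun x => f x * h x),
    integral_prod_mul, integral_prod_mul] at h0
  simp only [integral_const, probReal_univ, smul_eq_mul, mul_one, one_mul] at h0
  linarith [mul_comm (∫ x, f x ∂μ) (∫ x, h x ∂μ)]

/-- Association on a product space, for a function of one coordinate. -/
lemma integral_eval_mul_integral_le {p : ℕ} (ν : Fin p → Measure ℝ)
    [∀ j, IsProbabilityMeasure (ν j)] (j : Fin p) {f : ℝ → ℝ} {h : (Fin p → ℝ) → ℝ}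
    (hf : Monotone f) (hh : Monotone h) (hfi : Integrable f (ν j))
    (hhi : Integrable h (Measure.pi ν))
    (hfh : Integrable (fun r => f (r j) * h r) (Measure.pi ν)) :
    (∫ x, f x ∂(ν j)) * ∫ r, h r ∂(Measure.pi ν) ≤ ∫ r, f (r j) * h r ∂(Measure.pi ν) := by
  cases p with
  | zero => exact j.elim0
  | succ k =>
    have hmp := (measurePreserving_piFinSuccAbove ν j).symm
    have hemb := (MeasurableEquiv.piFinSuccAbove (fun _ : Fin (k + 1) => ℝ) j).symm.measurableEmbedding
    rw [← hmp.integral_comp hemb, ← hmp.integral_comp hemb]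
    rw [← hmp.integrable_comp_emb hemb] at hhi hfh
    simp only [Function.comp_def, MeasurableEquiv.piFinSuccAbove_symm_apply,
      Fin.insertNthEquiv_apply, Fin.insertNth_apply_same] at hhi hfh ⊢
    rw [integral_prod_symm _ hhi, integral_prod_symm _ hfh, ← integral_const_mul]
    refine integral_mono_ae (hhi.integral_prod_right.const_mul _) hfh.integral_prod_right ?_
    filter_upwards [hhi.prod_left_ae, hfh.prod_left_ae] with z h1 h2
    refine integral_mul_integral_le_of_monotone hf (fun a b hab => hh ?_) hfi h1 h2
    intro i
    refine j.succAboveCases ?_ (fun i => ?_) i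
    · simpa using hab
    · simp

/-- A product of measures with densities has the product density. -/
lemma pi_withDensity {ι : Type*} [Fintype ι] (ν : ι → Measure ℝ)
    [∀ j, IsProbabilityMeasure (ν j)] {k : ι → ℝ → ℝ} (hk0 : ∀ j x, 0 ≤ k j x)
    (hk : ∀ j, Integrable (k j) (ν j)) :
    Measure.pi (fun j => (ν j).withDensity fun x => ENNReal.ofReal (k j x)) =
      (Measure.pi ν).withDensity fun r => ENNReal.ofReal (∏ j, k j (r j)) := by
  have (j : ι) : IsFiniteMeasure ((ν j).withDensity fun x => ENNReal.ofReal (k j x)) :=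
    isFiniteMeasure_withDensity_ofReal (hk j).2
  refine Measure.pi_eq fun s hs => ?_
  have hi : ∀ j, Integrable ((s j).indicator (k j)) (ν j) := fun j => (hk j).indicator (hs j)
  have h0 : ∀ j x, 0 ≤ (s j).indicator (k j) x := fun j x =>
    Set.indicator_nonneg (fun x _ => hk0 j x) x
  have h1 : ∀ j, ((ν j).withDensity fun x => ENNReal.ofReal (k j x)) (s j) =
      ENNReal.ofReal (∫ x, (s j).indicator (k j) x ∂(ν j)) := by
    intro j
    rw [withDensity_apply _ (hs j), ← ofReal_integral_eq_lintegral_ofReal (hk j).integrableOn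
      (Filter.Eventually.of_forall (hk0 j)), integral_indicator (hs j)]
  have h2 : ∀ r : ι → ℝ, (Set.univ.pi s).indicator (fun r => ENNReal.ofReal (∏ j, k j (r j))) r =
      ENNReal.ofReal (∏ j, (s j).indicator (k j) (r j)) := by
    intro r
    by_cases hr : r ∈ Set.univ.pi s
    · rw [Set.indicator_of_mem hr]
      congr 1
      refine Finset.prod_congr rfl fun j _ => ?_
      rw [Set.indicator_of_mem (hr j (Set.mem_univ j))]
    · rw [Set.indicator_of_notMem hr]
      obtain ⟨j, hj⟩ : ∃ j, r j ∉ s j := by simpa [Set.mem_pi] using hr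
      rw [Finset.prod_eq_zero (Finset.mem_univ j) (Set.indicator_of_notMem hj _),
        ENNReal.ofReal_zero]
  simp only [h1]
  rw [withDensity_apply _ (MeasurableSet.univ_pi hs),
    ← lintegral_indicator (MeasurableSet.univ_pi hs)]
  simp only [h2]
  rw [← ofReal_integral_eq_lintegral_ofReal (Integrable.fintype_prod_dep hi)
    (Filter.Eventually.of_forall fun r => Finset.prod_nonneg fun j _ => h0 j _),
    integral_fintype_prod_eq_prod, ENNReal.ofReal_prod_of_nonneg]
  exact fun j _ => integral_nonneg (h0 j)

end Product

/-! ### The covariance bound for the optimal scale -/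

section Covariance

variable {p : ℕ} (S : Finset (Fin p)) {w : Fin p → ℝ}

lemma memLp_eval (j : Fin p) : MemLp (fun r : Fin p → ℝ => r j) 2 (Measure.pi (coordLaw S)) :=
  (memLp_coordLaw S j).comp_measurePreserving (measurePreserving_eval (coordLaw S) j)

lemma integral_comp_eval {f : ℝ → ℝ} (hf : Measurable f) (j : Fin p) :
    ∫ r, f (r j) ∂(Measure.pi (coordLaw S)) = ∫ x, f x ∂(coordLaw S j) := by
  rw [← (measurePreserving_eval (coordLaw S) j).map_eq,
    integral_map (measurable_pi_apply j).aemeasurable hf.aestronglyMeasurable]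

lemma integral_eval (j : Fin p) :
    ∫ r, r j ∂(Measure.pi (coordLaw S)) = if j ∈ S then 0 else √(2 / Real.pi) := by
  refine (integral_comp_eval S measurable_id j).trans ?_
  unfold coordLaw
  split_ifs
  · exact integral_id_gaussianReal
  · exact integral_id_halfNormal

lemma memLp_optScale (hw : ∀ j, 0 ≤ w j) :
    MemLp (optScale S w) 2 (Measure.pi (coordLaw S)) := by
  have h : MemLp (fun r : Fin p → ℝ => ∑ j, |r j| * (w j)⁻¹) 2 (Measure.pi (coordLaw S)) :=
    memLp_finsetSum _ fun j _ => (memLp_eval S j).abs.mul_const _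
  refine h.of_le (measurable_optScale hw).aestronglyMeasurable
    (Filter.Eventually.of_forall fun r => ?_)
  rw [Real.norm_of_nonneg optScale_nonneg]
  exact (optScale_le_sum hw).trans (le_abs_self _)

lemma memLp_weightedSum :
    MemLp (fun r : Fin p → ℝ => ∑ j, w j * r j) 2 (Measure.pi (coordLaw S)) :=
  memLp_finsetSum _ fun j _ => (memLp_eval S j).const_mul _

lemma integrable_shiftDensity (j : Fin p) {c : ℝ} (hc : 0 ≤ c) :
    Integrable (shiftDensity S j c) (coordLaw S j) := by
  refine ⟨(measurable_shiftDensity S j c).aestronglyMeasurable, ?_⟩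
  rw [hasFiniteIntegral_iff_ofReal (Filter.Eventually.of_forall (shiftDensity_nonneg S j c)),
    ← setLIntegral_univ, ← withDensity_apply _ MeasurableSet.univ, ← coordLaw_map_add S j hc]
  have : IsProbabilityMeasure ((coordLaw S j).map fun x => x + c) :=
    Measure.isProbabilityMeasure_map (by fun_prop)
  exact measure_lt_top _ _

/-- The density of the law of `r + ε w` with respect to the law of `r`. -/
noncomputable def shiftDensityPi (w : Fin p → ℝ) (ε : ℝ) (r : Fin p → ℝ) : ℝ :=
  ∏ j, shiftDensity S j (ε * w j) (r j)

lemma map_add_smul_pi (hw : ∀ j, 0 ≤ w j) {ε : ℝ} (hε : 0 ≤ ε) :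
    (Measure.pi (coordLaw S)).map (fun r j => r j + ε * w j) =
      (Measure.pi (coordLaw S)).withDensity fun r => ENNReal.ofReal (shiftDensityPi S w ε r) := by
  have hp (j : Fin p) : IsProbabilityMeasure ((coordLaw S j).map fun x => x + ε * w j) :=
    Measure.isProbabilityMeasure_map (by fun_prop)
  rw [Measure.pi_map_pi (f := fun j x => x + ε * w j) (fun j => by fun_prop)]
  simp only [coordLaw_map_add S _ (mul_nonneg hε (hw _))]
  exact pi_withDensity _ (fun j => shiftDensity_nonneg S j _)
    fun j => integrable_shiftDensity S j (mul_nonneg hε (hw j))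

lemma measurable_shiftDensityPi (w : Fin p → ℝ) (ε : ℝ) : Measurable (shiftDensityPi S w ε) :=
  Finset.measurable_fun_prod _ fun j _ =>
    (measurable_shiftDensity S j (ε * w j)).comp (measurable_pi_apply j)

lemma shiftDensityPi_nonneg (w : Fin p → ℝ) (ε : ℝ) (r : Fin p → ℝ) :
    0 ≤ shiftDensityPi S w ε r :=
  Finset.prod_nonneg fun j _ => shiftDensity_nonneg S j _ _

/-- The optimal scale grows by at most `ε` under the translation by `ε w`; in expectation, and
after changing variables. -/
lemma integral_optScale_mul_shiftDensityPi_le (hw : ∀ j, 0 ≤ w j) {ε : ℝ} (hε : 0 ≤ ε) :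
    Integrable (fun r => shiftDensityPi S w ε r * optScale S w r) (Measure.pi (coordLaw S)) ∧
      ∫ r, shiftDensityPi S w ε r * optScale S w r ∂(Measure.pi (coordLaw S)) ≤
        ∫ r, optScale S w r ∂(Measure.pi (coordLaw S)) + ε := by
  have hτ : Integrable (optScale S w) (Measure.pi (coordLaw S)) :=
    (memLp_optScale S hw).integrable one_le_two
  have hm : Measurable fun (r : Fin p → ℝ) j => r j + ε * w j := by fun_prop
  have hi : Integrable (fun r : Fin p → ℝ => optScale S w fun j => r j + ε * w j)
      (Measure.pi (coordLaw S)) := by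
    refine (hτ.add (integrable_const ε)).mono'
      ((measurable_optScale hw).comp hm).aestronglyMeasurable
      (Filter.Eventually.of_forall fun r => ?_)
    rw [Real.norm_of_nonneg optScale_nonneg]
    exact optScale_add_smul_le hw hε
  have hd : Measurable fun r => (shiftDensityPi S w ε r).toNNReal :=
    (measurable_shiftDensityPi S w ε).real_toNNReal
  have hmap := map_add_smul_pi S hw hε
  have e : ∀ r, (shiftDensityPi S w ε r).toNNReal • optScale S w r =
      shiftDensityPi S w ε r * optScale S w r := fun r => by
    rw [NNReal.smul_def, Real.coe_toNNReal _ (shiftDensityPi_nonneg S w ε r), smul_eq_mul]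
  constructor
  · have h1 : Integrable (optScale S w)
        ((Measure.pi (coordLaw S)).map (fun r j => r j + ε * w j)) :=
      (integrable_map_measure (measurable_optScale hw).aestronglyMeasurable hm.aemeasurable).2 hi
    rw [hmap] at h1
    have h2 := (integrable_withDensity_iff_integrable_smul hd).1 h1
    simpa only [e] using h2
  · have h1 : ∫ r, optScale S w r ∂((Measure.pi (coordLaw S)).map (fun r j => r j + ε * w j)) =
        ∫ r, shiftDensityPi S w ε r * optScale S w r ∂(Measure.pi (coordLaw S)) := by
      rw [hmap]
      refine (integral_withDensity_eq_integral_smul hd _).trans ?_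
      simp only [e]
    rw [← h1, integral_map hm.aemeasurable (measurable_optScale hw).aestronglyMeasurable]
    have h2 : ∫ r, (optScale S w r + ε) ∂(Measure.pi (coordLaw S)) =
        ∫ r, optScale S w r ∂(Measure.pi (coordLaw S)) + ε := by
      rw [integral_add hτ (integrable_const ε)]
      simp
    rw [← h2]
    exact integral_mono hi (hτ.add (integrable_const ε)) fun r => optScale_add_smul_le hw hε

/-- The vectors that are not translates by `ε w` of vectors with positive coordinates off `S`. -/
def gapSet (w : Fin p → ℝ) (ε : ℝ) : Set (Fin p → ℝ) :=
  {r | ∃ j, j ∉ S ∧ r j ≤ ε * w j}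

lemma measurableSet_gapSet (w : Fin p → ℝ) (ε : ℝ) : MeasurableSet (gapSet S w ε) := by
  have : gapSet S w ε = ⋃ j, ⋃ (_ : j ∉ S), {r : Fin p → ℝ | r j ≤ ε * w j} := by
    ext r
    simp [gapSet]
  rw [this]
  exact MeasurableSet.iUnion fun j => MeasurableSet.iUnion fun _ =>
    measurableSet_le (measurable_pi_apply j) measurable_const

lemma shiftDensityPi_eq_exp {ε : ℝ} {r : Fin p → ℝ} (hr : r ∉ gapSet S w ε) :
    shiftDensityPi S w ε r =
      Real.exp (ε * ∑ j, w j * r j - ε ^ 2 * ∑ j, w j ^ 2 / 2) := by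
  have h : ∀ j, shiftDensity S j (ε * w j) (r j) =
      Real.exp (ε * (w j * r j) - ε ^ 2 * (w j ^ 2 / 2)) := by
    intro j
    have : j ∈ S ∨ ε * w j < r j := by
      by_contra! h
      exact hr ⟨j, h.1, h.2⟩
    rw [shiftDensity, if_pos this]
    congr 1
    ring
  simp only [shiftDensityPi, h]
  rw [← Real.exp_sum, Finset.sum_sub_distrib, Finset.mul_sum, Finset.mul_sum]

/-- First-order lower bound for the translated density, tested against a nonnegative number. -/
lemma shiftDensityPi_mul_ge {ε a : ℝ} (hε : 0 ≤ ε) (ha : 0 ≤ a) (r : Fin p → ℝ) :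
    a + ε * (a * ∑ j, w j * r j) - ε ^ 2 * (∑ j, w j ^ 2 / 2) * a
        - ∑ j, (if j ∈ S then 0 else Set.indicator (Set.Iic (ε * w j)) 1 (r j) * a)
        - ε * Set.indicator (gapSet S w ε) (fun r => a * |∑ j, w j * r j|) r
      ≤ shiftDensityPi S w ε r * a := by
  have hterm : ∀ j, 0 ≤ (if j ∈ S then 0 else Set.indicator (Set.Iic (ε * w j)) 1 (r j) * a) := by
    intro j
    split_ifs
    · exact le_rfl
    · exact mul_nonneg (Set.indicator_nonneg (fun _ _ => zero_le_one) _) ha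
  by_cases hr : r ∈ gapSet S w ε
  · rw [Set.indicator_of_mem hr]
    obtain ⟨j, hj, hjr⟩ := hr
    have h1 := Finset.single_le_sum (fun i _ => hterm i) (Finset.mem_univ j)
    rw [if_neg hj, Set.indicator_of_mem (show r j ∈ Set.Iic (ε * w j) from hjr), Pi.one_apply,
      one_mul] at h1
    have h2 := mul_nonneg (shiftDensityPi_nonneg S w ε r) ha
    have h3 := mul_le_mul_of_nonneg_left
      (mul_le_mul_of_nonneg_left (le_abs_self (∑ j, w j * r j)) ha) hε
    have h4 : 0 ≤ ε ^ 2 * (∑ j, w j ^ 2 / 2) * a :=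
      mul_nonneg (mul_nonneg (sq_nonneg _) (Finset.sum_nonneg fun j _ => by positivity)) ha
    linarith
  · rw [Set.indicator_of_notMem hr, shiftDensityPi_eq_exp S hr]
    have h1 := Finset.sum_nonneg fun j (_ : j ∈ Finset.univ) => hterm j
    have h2 := mul_le_mul_of_nonneg_right
      (Real.add_one_le_exp (ε * ∑ j, w j * r j - ε ^ 2 * ∑ j, w j ^ 2 / 2)) ha
    linarith

/-- The event that a half-normal coordinate is small is negatively correlated with the optimal
scale. -/
lemma integral_indicator_mul_optScale_le (hw : ∀ j, 0 ≤ w j) {j : Fin p} (hj : j ∉ S) {c : ℝ}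
    (hc : 0 ≤ c) :
    Integrable (fun r => Set.indicator (Set.Iic c) 1 (r j) * optScale S w r)
        (Measure.pi (coordLaw S)) ∧
      ∫ r, Set.indicator (Set.Iic c) 1 (r j) * optScale S w r ∂(Measure.pi (coordLaw S)) ≤
        √(2 / Real.pi) * c * ∫ r, optScale S w r ∂(Measure.pi (coordLaw S)) := by
  have hτ : Integrable (optScale S w) (Measure.pi (coordLaw S)) :=
    (memLp_optScale S hw).integrable one_le_two
  have hm : Measurable (Set.indicator (Set.Iic c) (1 : ℝ → ℝ)) :=
    measurable_one.indicator measurableSet_Iic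
  have hi : Integrable (fun r => Set.indicator (Set.Iic c) 1 (r j) * optScale S w r)
      (Measure.pi (coordLaw S)) := by
    refine hτ.bdd_mul (c := 1) (hm.comp (measurable_pi_apply j)).aestronglyMeasurable
      (Filter.Eventually.of_forall fun r => ?_)
    rw [Set.indicator_apply]
    split_ifs <;> simp
  refine ⟨hi, ?_⟩
  have hmono : Monotone fun x => -Set.indicator (Set.Iic c) (1 : ℝ → ℝ) x := by
    intro x y hxy
    by_cases hy : y ≤ c
    · simp [Set.indicator_of_mem, hy, hxy.trans hy]
    · simp only [Set.indicator_of_notMem (show y ∉ Set.Iic c from hy), neg_zero, neg_nonpos]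
      exact Set.indicator_nonneg (fun _ _ => zero_le_one) _
  have hint : Integrable (Set.indicator (Set.Iic c) (1 : ℝ → ℝ)) (coordLaw S j) :=
    (integrable_const (1 : ℝ)).indicator measurableSet_Iic
  have h := integral_eval_mul_integral_le (coordLaw S) j hmono (optScale_mono (S := S) hw)
    hint.neg hτ (hi.neg.congr (Filter.Eventually.of_forall fun r => (neg_mul _ _).symm))
  simp only [neg_mul, integral_neg, integral_indicator_one measurableSet_Iic] at h
  have hle : (coordLaw S j).real (Set.Iic c) ≤ √(2 / Real.pi) * c := by
    rw [coordLaw, if_neg hj]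
    exact halfNormal_real_Iic_le hc
  have := mul_le_mul_of_nonneg_right hle
    (integral_nonneg fun r => optScale_nonneg (S := S) (w := w) (r := r) :
      0 ≤ ∫ r, optScale S w r ∂(Measure.pi (coordLaw S)))
  linarith

/-- Almost surely a vector leaves `gapSet S w ε` as `ε` decreases to zero, so integrals over these
sets vanish in the limit. -/
lemma tendsto_integral_gapSet {f : (Fin p → ℝ) → ℝ} (hf : Integrable f (Measure.pi (coordLaw S))) :
    Filter.Tendsto (fun n : ℕ => ∫ r, Set.indicator (gapSet S w (1 / ((n : ℝ) + 1))) f r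
      ∂(Measure.pi (coordLaw S))) Filter.atTop (nhds 0) := by
  rw [← integral_zero (Fin p → ℝ) ℝ (μ := Measure.pi (coordLaw S))]
  refine tendsto_integral_of_dominated_convergence (fun r => ‖f r‖)
    (fun n => hf.aestronglyMeasurable.indicator (measurableSet_gapSet S w _)) hf.norm
    (fun n => Filter.Eventually.of_forall fun r => norm_indicator_le_norm_self f r) ?_
  have hpos : ∀ᵐ r ∂(Measure.pi (coordLaw S)), ∀ j, j ∉ S → 0 < r j := by
    refine ae_all_iff.2 fun j => ?_
    by_cases hj : j ∈ S
    · simp [hj]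
    have h0 : coordLaw S j (Set.Iic 0) = 0 := by
      have := halfNormal_real_Iic_le le_rfl
      rw [mul_zero] at this
      rw [coordLaw, if_neg hj]
      exact (measureReal_eq_zero_iff).1 (le_antisymm this measureReal_nonneg)
    have h1 : ∀ᵐ x ∂(coordLaw S j), 0 < x := by
      rw [ae_iff]
      simpa [Set.Iic] using h0
    filter_upwards [(measurePreserving_eval (coordLaw S) j).quasiMeasurePreserving.ae h1]
      with r hr _
    exact hr
  filter_upwards [hpos] with r hr
  refine tendsto_const_nhds.congr' ?_
  have hev : ∀ᶠ n : ℕ in Filter.atTop, ∀ j, j ∉ S → 1 / ((n : ℝ) + 1) * w j < r j := by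
    refine Filter.eventually_all.2 fun j => ?_
    by_cases hj : j ∈ S
    · simp [hj]
    have h : Filter.Tendsto (fun n : ℕ => 1 / ((n : ℝ) + 1) * w j) Filter.atTop (nhds (0 * w j)) :=
      tendsto_one_div_add_atTop_nhds_zero_nat.mul_const _
    rw [zero_mul] at h
    filter_upwards [h.eventually (gt_mem_nhds (hr j hj))] with n hn _
    exact hn
  filter_upwards [hev] with n hn
  rw [Set.indicator_of_notMem]
  rintro ⟨j, hj, hle⟩
  exact absurd (hn j hj) (not_lt.2 hle)

/-- The covariance of `∑ w j * r j` and the optimal scale is at most one: it is the derivative of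
the expected optimal scale under the translations `r + ε w`, up to boundary terms of the right
sign. -/
lemma integral_optScale_mul_weightedSum_le (hw : ∀ j, 0 ≤ w j) :
    ∫ r, optScale S w r * ∑ j, w j * r j ∂(Measure.pi (coordLaw S)) ≤
      1 + (∑ j, if j ∈ S then 0 else √(2 / Real.pi) * w j) *
        ∫ r, optScale S w r ∂(Measure.pi (coordLaw S)) := by
  set μ := Measure.pi (coordLaw S)
  set M := ∫ r, optScale S w r ∂μ
  set c := ∑ j, w j ^ 2 / 2
  have hτ : Integrable (optScale S w) μ := (memLp_optScale S hw).integrable one_le_two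
  have hτR : Integrable (fun r => optScale S w r * ∑ j, w j * r j) μ :=
    (memLp_optScale S hw).integrable_mul (memLp_weightedSum S)
  have hτR' : Integrable (fun r => optScale S w r * |∑ j, w j * r j|) μ :=
    (memLp_optScale S hw).integrable_mul (memLp_weightedSum S).abs
  have key : ∀ ε : ℝ, 0 < ε → ∫ r, optScale S w r * ∑ j, w j * r j ∂μ ≤
      1 + (∑ j, if j ∈ S then 0 else √(2 / Real.pi) * w j) * M + ε * (c * M) +
        ∫ r, Set.indicator (gapSet S w ε) (fun r => optScale S w r * |∑ j, w j * r j|) r ∂μ := by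
    intro ε hε
    obtain ⟨hi, hle⟩ := integral_optScale_mul_shiftDensityPi_le S hw hε.le
    have hind : ∀ j, Integrable (fun r : Fin p → ℝ => if j ∈ S then 0 else
        Set.indicator (Set.Iic (ε * w j)) 1 (r j) * optScale S w r) μ := by
      intro j
      by_cases hj : j ∈ S
      · simp [hj]
      · simp only [hj, if_false]
        exact (integral_indicator_mul_optScale_le S hw hj (mul_nonneg hε.le (hw j))).1
    have hgap : Integrable (fun r => Set.indicator (gapSet S w ε)
        (fun r => optScale S w r * |∑ j, w j * r j|) r) μ :=
      hτR'.indicator (measurableSet_gapSet S w ε)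
    have i1 : Integrable (fun r => optScale S w r + ε * (optScale S w r * ∑ j, w j * r j)) μ :=
      hτ.add (hτR.const_mul ε)
    have i2 : Integrable (fun r => optScale S w r + ε * (optScale S w r * ∑ j, w j * r j)
        - ε ^ 2 * c * optScale S w r) μ := i1.sub (hτ.const_mul (ε ^ 2 * c))
    have i3s : Integrable (fun r : Fin p → ℝ => ∑ j, if j ∈ S then 0 else
        Set.indicator (Set.Iic (ε * w j)) 1 (r j) * optScale S w r) μ :=
      integrable_finsetSum _ fun j _ => hind j
    have i3 : Integrable (fun r => optScale S w r + ε * (optScale S w r * ∑ j, w j * r j)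
        - ε ^ 2 * c * optScale S w r - ∑ j, (if j ∈ S then 0 else
          Set.indicator (Set.Iic (ε * w j)) 1 (r j) * optScale S w r)) μ := i2.sub i3s
    have hmono := integral_mono (i3.sub (hgap.const_mul ε)) hi fun r =>
      shiftDensityPi_mul_ge S hε.le (optScale_nonneg (S := S) (w := w) (r := r)) r
    have hsum : ∑ j, ∫ r, (if j ∈ S then 0 else
        Set.indicator (Set.Iic (ε * w j)) 1 (r j) * optScale S w r) ∂μ ≤
        ε * ((∑ j, if j ∈ S then 0 else √(2 / Real.pi) * w j) * M) := by
      rw [Finset.sum_mul, Finset.mul_sum]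
      refine Finset.sum_le_sum fun j _ => ?_
      by_cases hj : j ∈ S
      · simp [hj]
      · simp only [hj, if_false]
        refine (integral_indicator_mul_optScale_le S hw hj (mul_nonneg hε.le (hw j))).2.trans
          (le_of_eq ?_)
        ring
    have heq : ∫ r, (optScale S w r + ε * (optScale S w r * ∑ j, w j * r j)
        - ε ^ 2 * c * optScale S w r - ∑ j, (if j ∈ S then 0 else
          Set.indicator (Set.Iic (ε * w j)) 1 (r j) * optScale S w r)
        - ε * Set.indicator (gapSet S w ε) (fun r => optScale S w r * |∑ j, w j * r j|) r) ∂μ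
        = M + ε * (∫ r, optScale S w r * ∑ j, w j * r j ∂μ) - ε ^ 2 * c * M
        - ∑ j, ∫ r, (if j ∈ S then 0 else
          Set.indicator (Set.Iic (ε * w j)) 1 (r j) * optScale S w r) ∂μ
        - ε * ∫ r, Set.indicator (gapSet S w ε)
          (fun r => optScale S w r * |∑ j, w j * r j|) r ∂μ := by
      rw [integral_sub i3 (hgap.const_mul ε), integral_sub i2 i3s,
        integral_sub i1 (hτ.const_mul _), integral_add hτ (hτR.const_mul ε), integral_const_mul,
        integral_const_mul, integral_const_mul, integral_finsetSum _ fun j _ => hind j]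
    have hfin := (heq.symm.trans_le hmono).trans hle
    refine le_of_mul_le_mul_left ?_ hε
    nlinarith
  have hlim1 : Filter.Tendsto (fun n : ℕ => 1 +
      (∑ j, if j ∈ S then 0 else √(2 / Real.pi) * w j) * M + 1 / ((n : ℝ) + 1) * (c * M) +
      ∫ r, Set.indicator (gapSet S w (1 / ((n : ℝ) + 1)))
        (fun r => optScale S w r * |∑ j, w j * r j|) r ∂μ) Filter.atTop
      (nhds (1 + (∑ j, if j ∈ S then 0 else √(2 / Real.pi) * w j) * M + 0 * (c * M) + 0)) :=
    (tendsto_const_nhds.add (tendsto_one_div_add_atTop_nhds_zero_nat.mul_const _)).add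
      (tendsto_integral_gapSet S hτR')
  rw [zero_mul, add_zero, add_zero] at hlim1
  exact ge_of_tendsto' hlim1 fun n => key _ (by positivity)

end Covariance

/-! ### Comparing the expected infimum with the infimum of the expectation -/

section Gap

variable {p : ℕ} (S : Finset (Fin p)) {w : Fin p → ℝ}

lemma memLp_residual (t : ℝ) (j : Fin p) :
    MemLp (fun r => residual S w r t j) 2 (Measure.pi (coordLaw S)) := by
  have h : MemLp (fun r : Fin p → ℝ => r j - t * w j) 2 (Measure.pi (coordLaw S)) :=
    (memLp_eval S j).sub (memLp_const _)
  unfold residual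
  by_cases hj : j ∈ S
  · simpa only [hj, if_true] using h
  · simp only [hj, if_false]
    have hm : Measurable fun r : Fin p → ℝ => max (r j - t * w j) 0 := by fun_prop
    refine h.of_le hm.aestronglyMeasurable (Filter.Eventually.of_forall fun r => ?_)
    rw [Real.norm_eq_abs, Real.norm_eq_abs, abs_of_nonneg (le_max_right _ _)]
    exact max_le (le_abs_self _) (abs_nonneg _)

lemma memLp_slope (t : ℝ) :
    MemLp (fun r => slope S w r t) 2 (Measure.pi (coordLaw S)) :=
  memLp_finsetSum _ fun j _ => (memLp_residual S t j).const_mul _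

lemma integrable_sqDist (t : ℝ) :
    Integrable (fun r => sqDist S w r t) (Measure.pi (coordLaw S)) :=
  integrable_finsetSum _ fun j _ => (memLp_residual S t j).integrable_sq

lemma integral_sqDist (hw : ∀ j, 0 ≤ w j) {t : ℝ} (ht : 0 ≤ t) :
    ∫ r, sqDist S w r t ∂(Measure.pi (coordLaw S)) =
      ∑ j, if j ∈ S then t ^ 2 * w j ^ 2 + 1 else phi (t * w j) := by
  unfold sqDist
  rw [integral_finsetSum _ fun j _ => (memLp_residual S t j).integrable_sq]
  refine Finset.sum_congr rfl fun j _ => ?_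
  unfold residual
  by_cases hj : j ∈ S
  · simp only [hj, if_true]
    rw [integral_comp_eval S (f := fun x => (x - t * w j) ^ 2) (by fun_prop), coordLaw, if_pos hj,
      integral_sub_sq_gaussianReal]
    ring
  · simp only [hj, if_false]
    rw [integral_comp_eval S (f := fun x => max (x - t * w j) 0 ^ 2) (by fun_prop), coordLaw,
      if_neg hj, integral_soft_sq_halfNormal (mul_nonneg ht (hw j))]

/-- At any fixed scale, the covariance of the slope and the optimal scale is at most one. The slope
is `∑ w j * r j` minus nondecreasing functions of single coordinates, which are nonnegatively
correlated with the optimal scale. -/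
lemma integral_slope_mul_le (hw : ∀ j, 0 ≤ w j) (t : ℝ) :
    ∫ r, slope S w r t * (optScale S w r - ∫ r, optScale S w r ∂(Measure.pi (coordLaw S)))
      ∂(Measure.pi (coordLaw S)) ≤ 1 := by
  set μ := Measure.pi (coordLaw S)
  set M := ∫ r, optScale S w r ∂μ
  have hτ : Integrable (optScale S w) μ := (memLp_optScale S hw).integrable one_le_two
  -- the part of a coordinate that is removed by taking the residual; it is monotone in the coordinate
  let q : Fin p → ℝ → ℝ := fun j x => if j ∈ S then t * w j else min x (t * w j)
  have hq : ∀ r, slope S w r t = ∑ j, w j * r j - ∑ j, w j * q j (r j) := by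
    intro r
    rw [slope, ← Finset.sum_sub_distrib]
    refine Finset.sum_congr rfl fun j _ => ?_
    rw [← mul_sub]
    congr 1
    simp only [residual, q]
    split_ifs
    · rfl
    · rcases le_total (r j) (t * w j) with h | h
      · rw [max_eq_right (by linarith), min_eq_left h, sub_self]
      · rw [max_eq_left (by linarith), min_eq_right h]
  have hqm : ∀ j, Monotone (q j) := by
    intro j x y hxy
    simp only [q]
    split_ifs
    · exact le_rfl
    · exact min_le_min_right _ hxy
  have hqL : ∀ j, MemLp (q j) 2 (coordLaw S j) := by
    intro j
    by_cases hj : j ∈ S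
    · simp only [q, hj, if_true]
      exact memLp_const _
    · have h : MemLp (fun x : ℝ => x ⊓ t * w j) 2 (coordLaw S j) :=
        (memLp_coordLaw S j).inf (memLp_const _)
      simpa only [q, hj, if_false] using h
  have hqL' : ∀ j, MemLp (fun r : Fin p → ℝ => q j (r j)) 2 μ := fun j =>
    (hqL j).comp_measurePreserving (measurePreserving_eval (coordLaw S) j)
  have hqi : ∀ j, ∫ r, q j (r j) ∂μ = ∫ x, q j x ∂(coordLaw S j) := fun j =>
    integral_comp_eval S (hqm j).measurable j
  have hqτ : ∀ j, Integrable (fun r : Fin p → ℝ => q j (r j) * optScale S w r) μ := fun j =>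
    (hqL' j).integrable_mul (memLp_optScale S hw)
  have hassoc : ∀ j, (∫ r, q j (r j) ∂μ) * M ≤ ∫ r, q j (r j) * optScale S w r ∂μ := fun j => by
    rw [hqi]
    exact integral_eval_mul_integral_le (coordLaw S) j (hqm j) (optScale_mono hw)
      ((hqL j).integrable one_le_two) hτ (hqτ j)
  have hτR : Integrable (fun r => optScale S w r * ∑ j, w j * r j) μ :=
    (memLp_optScale S hw).integrable_mul (memLp_weightedSum S)
  have hR : Integrable (fun r : Fin p → ℝ => ∑ j, w j * r j) μ :=
    (memLp_weightedSum S).integrable one_le_two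
  have hER : ∫ r, ∑ j, w j * r j ∂μ = ∑ j, if j ∈ S then 0 else √(2 / Real.pi) * w j := by
    rw [integral_finsetSum _ fun j _ => ((memLp_eval S j).integrable one_le_two).const_mul (w j)]
    refine Finset.sum_congr rfl fun j _ => ?_
    rw [integral_const_mul, integral_eval]
    split_ifs
    · exact mul_zero _
    · exact mul_comm _ _
  have hq1 : ∀ j, Integrable (fun r : Fin p → ℝ =>
      w j * (q j (r j) * optScale S w r - M * q j (r j))) μ := fun j =>
    ((hqτ j).sub (((hqL' j).integrable one_le_two).const_mul M)).const_mul (w j)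
  have hq2 : 0 ≤ ∫ r, ∑ j, w j * (q j (r j) * optScale S w r - M * q j (r j)) ∂μ := by
    rw [integral_finsetSum _ fun j _ => hq1 j]
    refine Finset.sum_nonneg fun j _ => ?_
    rw [integral_const_mul, integral_sub (hqτ j) (((hqL' j).integrable one_le_two).const_mul M),
      integral_const_mul]
    exact mul_nonneg (hw j) (by linarith [hassoc j, mul_comm M (∫ r, q j (r j) ∂μ)])
  have e : (fun r => slope S w r t * (optScale S w r - M)) = fun r =>
      (optScale S w r * ∑ j, w j * r j - M * ∑ j, w j * r j) -
        ∑ j, w j * (q j (r j) * optScale S w r - M * q j (r j)) := by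
    ext r
    have : ∑ j, w j * (q j (r j) * optScale S w r - M * q j (r j)) =
        (∑ j, w j * q j (r j)) * (optScale S w r - M) := by
      rw [Finset.sum_mul]
      exact Finset.sum_congr rfl fun j _ => by ring
    rw [this, hq]
    ring
  have i1 : Integrable (fun r => optScale S w r * ∑ j, w j * r j - M * ∑ j, w j * r j) μ :=
    hτR.sub (hR.const_mul M)
  rw [e, integral_sub i1 (integrable_finsetSum _ fun j _ => hq1 j),
    integral_sub hτR (hR.const_mul M), integral_const_mul, hER]
  have := integral_optScale_mul_weightedSum_le S hw
  linarith [mul_comm M (∑ j, if j ∈ S then 0 else √(2 / Real.pi) * w j)]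

end Gap

section StatDim

variable {p : ℕ} {w : Fin p → ℝ}

lemma measurable_folded (y : EuclideanSpace ℝ (Fin p)) :
    Measurable fun g : EuclideanSpace ℝ (Fin p) => folded y g := by
  refine measurable_pi_lambda _ fun j => ?_
  unfold folded
  split_ifs <;> fun_prop

lemma integral_folded (y : EuclideanSpace ℝ (Fin p)) {f : (Fin p → ℝ) → ℝ}
    (hf : AEStronglyMeasurable f (Measure.pi (coordLaw (supp y)))) :
    ∫ g : EuclideanSpace ℝ (Fin p), f (folded y g) ∂(stdGaussian (EuclideanSpace ℝ (Fin p))) =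
      ∫ r, f r ∂(Measure.pi (coordLaw (supp y))) := by
  rw [← map_folded_stdGaussian] at hf ⊢
  rw [integral_map (measurable_folded y).aemeasurable hf]

lemma integrable_folded (y : EuclideanSpace ℝ (Fin p)) {f : (Fin p → ℝ) → ℝ}
    (hf : Integrable f (Measure.pi (coordLaw (supp y)))) :
    Integrable (fun g : EuclideanSpace ℝ (Fin p) => f (folded y g))
      (stdGaussian (EuclideanSpace ℝ (Fin p))) := by
  rw [← map_folded_stdGaussian] at hf
  exact hf.comp_measurable (measurable_folded y)

lemma integrable_infDist_sq (hw : ∀ j, 0 ≤ w j) (y : EuclideanSpace ℝ (Fin p)) :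
    Integrable (fun g => Metric.infDist g (polarCone (descentCone (weightedL1 w) y)) ^ 2)
      (stdGaussian (EuclideanSpace ℝ (Fin p))) := by
  refine (integrable_folded y (integrable_sqDist (w := w) (supp y) 0)).mono'
    ((Metric.continuous_infDist_pt _).pow 2).aestronglyMeasurable
    (Filter.Eventually.of_forall fun g => ?_)
  rw [Real.norm_of_nonneg (sq_nonneg _)]
  exact infDist_polarCone_sq_le hw g le_rfl

lemma statDim_le (hw : ∀ j, 0 ≤ w j) (y : EuclideanSpace ℝ (Fin p)) {t : ℝ} (ht : 0 ≤ t) :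
    statDim (descentCone (weightedL1 w) y) ≤
      ∑ j, if j ∈ supp y then t ^ 2 * w j ^ 2 + 1 else phi (t * w j) := by
  have hi := integrable_sqDist (w := w) (supp y) t
  rw [← integral_sqDist (supp y) hw ht, ← integral_folded y hi.aestronglyMeasurable]
  exact integral_mono (integrable_infDist_sq hw y) (integrable_folded y hi)
    fun g => infDist_polarCone_sq_le hw g ht

/-- The expected optimal scale is a deterministic scale whose expected squared distance exceeds the
statistical dimension by at most two. -/
lemma exists_scale_le_statDim (hw : ∀ j, 0 ≤ w j) (y : EuclideanSpace ℝ (Fin p)) :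
    ∃ t : ℝ, 0 ≤ t ∧ (∑ j, if j ∈ supp y then t ^ 2 * w j ^ 2 + 1 else phi (t * w j)) - 2 ≤
      statDim (descentCone (weightedL1 w) y) := by
  set S := supp y
  set M := ∫ r, optScale S w r ∂(Measure.pi (coordLaw S))
  have hM : 0 ≤ M := integral_nonneg fun r => optScale_nonneg
  -- centring at the mean of the optimal scale makes the first-order term a covariance
  refine ⟨M, hM, ?_⟩
  have i1 := integrable_sqDist (w := w) S M
  have i2 : Integrable (fun r => slope S w r M * (optScale S w r - M))
      (Measure.pi (coordLaw S)) :=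
    (memLp_slope S M).integrable_mul ((memLp_optScale S hw).sub (memLp_const M))
  have i3 : Integrable (fun r => sqDist S w r M - 2 * (slope S w r M * (optScale S w r - M)))
      (Measure.pi (coordLaw S)) := i1.sub (i2.const_mul 2)
  have hle : ∫ r, (sqDist S w r M - 2 * (slope S w r M * (optScale S w r - M)))
      ∂(Measure.pi (coordLaw S)) ≤ statDim (descentCone (weightedL1 w) y) := by
    rw [← integral_folded y i3.aestronglyMeasurable]
    refine integral_mono (integrable_folded y i3) (integrable_infDist_sq hw y) fun g => ?_
    refine le_trans ?_ (sqDist_optScale_le_infDist_sq hw g)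
    rw [← mul_assoc]
    exact sqDist_tangent M (optScale S w (folded y g))
  rw [integral_sub i1 (i2.const_mul 2), integral_const_mul, integral_sqDist S hw hM] at hle
  linarith [integral_slope_mul_le S hw M]

end StatDim

/-! ### Block weights -/

section Blocks

variable {p L : ℕ} {P : Fin L → Finset (Fin p)} {ω : Fin L → ℝ}

lemma blockWeights_of_mem (hP : IsPartition P) {i : Fin L} {j : Fin p} (hj : j ∈ P i) :
    blockWeights P ω j = ω i := by
  unfold blockWeights
  rw [Finset.sum_eq_single i]
  · simp [hj]
  · intro k _ hk
    rw [if_neg fun h => Finset.disjoint_left.1 (hP.2.1 k i hk) h hj, mul_zero]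
  · simp

lemma blockWeights_nonneg (hω : ∀ i, 0 ≤ ω i) (j : Fin p) : 0 ≤ blockWeights P ω j :=
  Finset.sum_nonneg fun i _ => mul_nonneg (hω i) (by split_ifs <;> norm_num)

lemma sum_eq_sum_parts (hP : IsPartition P) (f : Fin p → ℝ) :
    ∑ j, f j = ∑ i, ∑ j ∈ P i, f j := by
  rw [← Finset.sum_biUnion fun i _ k _ h => hP.2.1 i k h]
  refine Finset.sum_congr ?_ fun _ _ => rfl
  ext j
  simpa using hP.2.2 j

lemma card_parts_le (hP : IsPartition P) : L ≤ p := by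
  choose f hf using hP.1
  have hinj : Function.Injective f := by
    intro i k h
    by_contra hne
    exact Finset.disjoint_left.1 (hP.2.1 i k hne) (hf i) (h ▸ hf k)
  simpa using Fintype.card_le_of_injective f hinj

lemma natCast_mul_Psi (hp : 0 < p) (hP : IsPartition P) (S : Finset (Fin p)) (t : ℝ) :
    (p : ℝ) * Psi (relSize P) (accuracy P S) ω t =
      ∑ j, if j ∈ S then t ^ 2 * blockWeights P ω j ^ 2 + 1 else phi (t * blockWeights P ω j) := by
  rw [sum_eq_sum_parts hP, Psi, Finset.mul_sum]
  refine Finset.sum_congr rfl fun i _ => ?_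
  have hsum : ∑ j ∈ P i, (if j ∈ S then t ^ 2 * blockWeights P ω j ^ 2 + 1
      else phi (t * blockWeights P ω j)) =
      ∑ j ∈ P i, (if j ∈ S then t ^ 2 * ω i ^ 2 + 1 else phi (t * ω i)) :=
    Finset.sum_congr rfl fun j hj => by rw [blockWeights_of_mem hP hj]
  have hcard : (({j ∈ P i | j ∉ S} : Finset (Fin p)).card : ℝ) =
      (P i).card - ((P i ∩ S).card : ℝ) := by
    rw [← Finset.filter_mem_eq_inter, eq_sub_iff_add_eq, add_comm]
    exact_mod_cast Finset.card_filter_add_card_filter_not (s := P i) (fun j => j ∈ S)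
  have h0 : ((P i).card : ℝ) ≠ 0 := by
    exact_mod_cast (Finset.card_pos.2 (hP.1 i)).ne'
  have hp0 : (p : ℝ) ≠ 0 := by exact_mod_cast hp.ne'
  rw [hsum, Finset.sum_ite, Finset.sum_const, Finset.sum_const, nsmul_eq_mul, nsmul_eq_mul, hcard,
    Finset.filter_mem_eq_inter, relSize, accuracy]
  field_simp

end Blocks

end WeightedAnalysis

theorem mainTheorem9 (p n L : ℕ) (Ω : Matrix (Fin p) (Fin n) ℝ)
    (hΩ : 0 < WeightedAnalysis.sigmaMin Ω)
    (P : Fin L → Finset (Fin p)) (hP : WeightedAnalysis.IsPartition P)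
    (ω : Fin L → ℝ) (hω : ∀ i, 0 ≤ ω i)
    (x : EuclideanSpace ℝ (Fin n)) :
    WeightedAnalysis.numMeasHat Ω P ω x
          - 2 * WeightedAnalysis.kappa Ω ^ 2 / √((p : ℝ) * (L : ℝ))
        ≤ WeightedAnalysis.numMeas Ω (WeightedAnalysis.blockWeights P ω) x ∧
      WeightedAnalysis.numMeas Ω (WeightedAnalysis.blockWeights P ω) x
        ≤ WeightedAnalysis.numMeasHat Ω P ω x := by
  open WeightedAnalysis in
  have hp : 0 < p := by
    by_contra! h
    obtain rfl : p = 0 := by omega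
    have hpos := (LinearMap.singularValues_pos_iff_lt_finrank_range _).1 hΩ
    have hle := Submodule.finrank_le (Matrix.toEuclideanLin Ω).range
    rw [finrank_euclideanSpace_fin] at hle
    omega
  have hp0 : (0 : ℝ) < p := by exact_mod_cast hp
  have hLp : (L : ℝ) ≤ p := by exact_mod_cast card_parts_le hP
  have hL : (0 : ℝ) < L := by
    obtain ⟨i, -⟩ := hP.2.2 ⟨0, hp⟩
    exact_mod_cast i.pos
  have hw : ∀ j, 0 ≤ blockWeights P ω j := blockWeights_nonneg hω
  set y := analyze Ω x with hy
  set δ := statDim (descentCone (weightedL1 (blockWeights P ω)) y)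
  set Ψ : ℝ → ℝ := Psi (relSize P) (accuracy P (supp y)) ω
  have hΨ : ∀ t, (p : ℝ) * Ψ t = _ := natCast_mul_Psi hp hP (supp y)
  have hlow : ∀ t, 0 ≤ t → δ / p ≤ Ψ t := by
    intro t ht
    rw [div_le_iff₀' hp0, hΨ]
    exact statDim_le hw y ht
  have hbdd : BddBelow (Set.range fun t : Set.Ici (0 : ℝ) => Ψ t) := by
    refine ⟨δ / p, ?_⟩
    rintro _ ⟨t, rfl⟩
    exact hlow t t.2
  have h1 : δ / p ≤ ⨅ t : Set.Ici (0 : ℝ), Ψ t := le_ciInf fun t => hlow t t.2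
  have h2 : (⨅ t : Set.Ici (0 : ℝ), Ψ t) - 2 / √((p : ℝ) * L) ≤ δ / p := by
    obtain ⟨t, ht, hle⟩ := exists_scale_le_statDim hw y
    rw [← hΨ] at hle
    have h3 : (⨅ t : Set.Ici (0 : ℝ), Ψ t) ≤ Ψ t := ciInf_le hbdd (⟨t, ht⟩ : Set.Ici (0 : ℝ))
    have h4 : Ψ t - 2 / p ≤ δ / p := by
      rw [le_div_iff₀ hp0, sub_mul, div_mul_cancel₀ _ hp0.ne', mul_comm]
      exact hle
    have h5 : √((p : ℝ) * L) ≤ p := by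
      rw [Real.sqrt_le_left hp0.le, sq]
      exact mul_le_mul_of_nonneg_left hLp hp0.le
    have h6 : 2 / (p : ℝ) ≤ 2 / √((p : ℝ) * L) :=
      div_le_div_of_nonneg_left zero_le_two (Real.sqrt_pos.2 (mul_pos hp0 hL)) h5
    linarith
  have hk : 0 ≤ kappa Ω ^ 2 := sq_nonneg _
  unfold numMeasHat numMeas
  constructor
  · have := mul_le_mul_of_nonneg_left h2 hk
    rw [mul_sub, mul_div_assoc', mul_comm _ (2 : ℝ)] at this
    linarith
  · have := mul_le_mul_of_nonneg_left h1 hk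
    linarith
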